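/- **Setting.** For a quantum state (density matrix) $\rho$ on a finite-dimensional space, a power $k\in\mathbb N$ and an accuracy $0<\epsilon\le 1$ put $t=\lfloor\ln(2k/\epsilon)\rfloor$, and assume that $k$ is large in the sense that $t\ge 4$ (that is, $2k/\epsilon\ge e^4$). Put $$\varepsilon_\ast=\frac{\epsilon}{2kt\ln t}.$$ Given numbers $Q_1,\dots,Q_t\in\mathbb C$ (estimates of $\mathrm{Tr}(\rho),\dots,\mathrm{Tr}(\rho^t)$), define $$b_0=1,\qquad b_m=\frac1m\sum_{i=1}^m(-1)^{i-1}b_{m-i}Q_i\ \ (1\le m\le t),\qquad Q_\ell=\sum_{j=1}^t(-1)^{j-1}b_jQ_{\ell-j}\ \ (\ell>t).$$ **Corollary.** (1) It suffices to estimate $\mathrm{Tr}(\rho^j)$ for $j\le t$: if $|Q_j-\mathrm{Tr}(\rho^j)|<\varepsilon_\ast$ for all $1\le j\le t$, then $|Q_i-\mathrm{Tr}(\rho^i)|<\epsilon$ for all $1\le i\le k$. (2) There are absolute constants $A,a,B$ and, for all $n,j\ge1$, a quantum circuit $C_{n,j}$ that acts on $j$ copies of an $n$-qubit state $\rho$ and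 on ancilla qubits in the state $|0\rangle$, consists of Hadamard, Pauli-$X$, CNOT and CSWAP gates, mid-circuit computational-basis measurements and classical feed-forward, and outputs one bit, such that $C_{n,j}$ has quantum depth at most $B$ (constant depth), at most $B\,nj$ qubits and at most $B\,nj$ CSWAPs (that is, $O(j)$ qubits and $O(j)$ CSWAPs for states of a fixed number $n$ of qubits), and the following holds. For all $k,\epsilon$ as above and all $\delta\in(0,1)$ there is a number $N$ of runs with $$t\,N\ \le\ A\,\bigl(\ln(2k/\epsilon)\bigr)^{a}\cdot\frac{k^2}{\epsilon^2}\,\ln\frac{2}{\delta},$$ that is, a total of $\tilde O\bigl(\tfrac{k^2}{\epsilon^2}\ln\tfrac1\delta\bigr)$ runs, such that for every $n\ge 1$ and every $n$-qubit state $\rho$: if for each $j\le t$ the circuit $C_{n,j}$ is run $N$ times on $\rho^{\otimes j}$, all runs being independent, and $Q_j$ is the mean of $(-1)^{\text{output bit}}$ over these $N$ runs, then with probability at least $1-\delta$ one has $|Q_j-\mathrm{Tr}(\rho^j)|<\varepsilon_\ast$ for all $1\le j\le t$ and $|Q_i-\mathrm{Tr}(\rho^i)|<\epsilon$ for all $1\le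 i\le k$. -/

import Mathlib

open scoped Matrix ComplexOrder

noncomputable section

/-! ## Quantum states -/

/-- A quantum state (density matrix) on the finite-dimensional space with basis `ι`:
a positive semidefinite matrix of trace one. -/
structure QState (ι : Type*) [Fintype ι] where
  mat : Matrix ι ι ℂ
  posSemidef : mat.PosSemidef
  trace_eq_one : mat.trace = 1

/-! ## The classical Newton-Girard post-processing -/

/-- The numbers `b_m` computed from (estimated) power sums `Q 1, Q 2, …` by
`b_0 = 1`, `b_m = (1 / m) ∑_{i=1}^m (-1)^(i-1) b_{m-i} Q_i`. -/
def newtonElem (Q : ℕ → ℂ) : ℕ → ℂ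
  | 0 => 1
  | m + 1 => (1 / ((m : ℂ) + 1)) *
      ∑ i : Fin (m + 1), (-1) ^ (i : ℕ) * newtonElem Q (m - i) * Q (i + 1)
  decreasing_by omega

/-- The extension of `Q 1, …, Q t` to all indices: unchanged up to `t`, and
`Q_l = ∑_{j=1}^t (-1)^(j-1) b_j Q_{l-j}` for `l > t`. Only `Q 1, …, Q t` are used when `l ≥ 1`. -/
def newtonPower (Q : ℕ → ℂ) (t : ℕ) (l : ℕ) : ℂ :=
  if l ≤ t then Q l
  else ∑ j : Fin t, (-1) ^ (j : ℕ) * newtonElem Q (j + 1) * newtonPower Q t (l - (j + 1))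
  termination_by l
  decreasing_by omega

/-! ## Quantum circuits with mid-circuit measurement and classical feed-forward -/

section Circuits

variable {W : Type} [Fintype W] [DecidableEq W]

/-- The elementary gates on a set `W` of qubits. -/
inductive Gate (W : Type) where
  | hadamard (a : W)
  | pauliX (a : W)
  | cnot (c a : W) (hca : c ≠ a)
  | cswap (c a b : W) (hca : c ≠ a) (hcb : c ≠ b) (hab : a ≠ b)

/-- The qubits on which a gate acts. -/
def Gate.support : Gate W → Finset W
  | .hadamard a => {a}
  | .pauliX a => {a}
  | .cnot c a _ => {c, a}
  | .cswap c a b _ _ _ => {c, a, b}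

/-- Is the gate a controlled SWAP? -/
def Gate.isCSwap : Gate W → Bool
  | .cswap _ _ _ _ _ _ => true
  | _ => false

/-- The action on computational basis states of a NOT on `a`, conditioned on the bit `v x`. -/
def flipIf (a : W) (v : (W → Bool) → Bool) (x : W → Bool) : W → Bool :=
  Function.update x a (xor (x a) (v x))

/-- The action on computational basis states of a controlled SWAP. -/
def swapIf (c a b : W) (x : W → Bool) : W → Bool :=
  if x c then x ∘ Equiv.swap a b else x

/-- The matrix `∑_x |f x⟩⟨x|`. -/
def basisMap (f : (W → Bool) → (W → Bool)) : Matrix (W → Bool) (W → Bool) ℂ :=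
  Matrix.of fun y x => if y = f x then 1 else 0

/-- The unitary matrix of a gate in the computational basis of the qubits `W`. -/
def Gate.matrix : Gate W → Matrix (W → Bool) (W → Bool) ℂ
  | .hadamard a => Matrix.of fun y x =>
      if ∀ w, w ≠ a → y w = x w then
        (if y a && x a then -1 else 1) / ((Real.sqrt 2 : ℝ) : ℂ)
      else 0
  | .pauliX a => basisMap (flipIf a fun _ => true)
  | .cnot c a _ => basisMap (flipIf a fun x => x c)
  | .cswap c a b _ _ _ => basisMap (swapIf c a b)

/-- A layer: gates acting on pairwise disjoint sets of qubits, hence executed in parallel. -/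
structure Layer (W : Type) [DecidableEq W] where
  gates : List (Gate W)
  disjoint : gates.Pairwise fun g h => Disjoint g.support h.support

/-- The unitary of a layer. -/
def Layer.matrix (L : Layer W) : Matrix (W → Bool) (W → Bool) ℂ :=
  (L.gates.map Gate.matrix).prod

/-- The number of controlled SWAPs in a layer. -/
def Layer.cswaps (L : Layer W) : ℕ := L.gates.countP Gate.isCSwap

/-- An adaptive quantum program. It either halts with a classical output bit, or executes one
layer of gates, measures the qubits in `M` in the computational basis, and continues in a way that
may depend on all the outcomes so far. -/
inductive Prog (W : Type) [DecidableEq W] where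
  | halt (out : Bool)
  | round (L : Layer W) (M : Finset W) (next : (M → Bool) → Prog W)

/-- The projection onto the outcome `o` of measuring the qubits in `M`. -/
def measProj (M : Finset W) (o : M → Bool) : Matrix (W → Bool) (W → Bool) ℂ :=
  Matrix.diagonal fun x => if ∀ w : M, x w = o w then 1 else 0

/-- The (unnormalized) state after a layer `L` and outcome `o` of measuring the qubits in `M`. -/
def postState (L : Layer W) (M : Finset W) (o : M → Bool)
    (σ : Matrix (W → Bool) (W → Bool) ℂ) : Matrix (W → Bool) (W → Bool) ℂ :=
  (measProj M o * L.matrix) * σ * (measProj M o * L.matrix)ᴴ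

/-- Born's rule: the probability that the program outputs `b` when started in `σ`. -/
def Prog.prob : Prog W → Matrix (W → Bool) (W → Bool) ℂ → Bool → ℝ
  | .halt out, σ, b => if b = out then σ.trace.re else 0
  | .round L M next, σ, b => ∑ o : M → Bool, (next o).prob (postState L M o σ) b

/-- Quantum depth: the maximal number of rounds (a layer of gates and a measurement). -/
def Prog.depth : Prog W → ℕ
  | .halt _ => 0
  | .round _ M next => 1 + Finset.univ.sup fun o : M → Bool => (next o).depth

/-- The maximal number of controlled SWAPs executed in a run. -/
def Prog.cswaps : Prog W → ℕ
  | .halt _ => 0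
  | .round L M next => L.cswaps + Finset.univ.sup fun o : M → Bool => (next o).cswaps

end Circuits

/-- A circuit that takes `j` copies of a state of `n` qubits and some ancilla qubits. The qubit
`Sum.inl (c, q)` is the `q`-th qubit of the `c`-th copy. -/
structure Circuit (n j : ℕ) where
  ancillas : ℕ
  prog : Prog ((Fin j × Fin n) ⊕ Fin ancillas)

/-- The total number of qubits of a circuit. -/
def Circuit.qubits {n j : ℕ} (C : Circuit n j) : ℕ := j * n + C.ancillas

/-- The input `ρ ⊗ ⋯ ⊗ ρ ⊗ |0⋯0⟩⟨0⋯0|`, with `j` copies of `ρ` and `a` ancillas. -/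
def inputState {n : ℕ} (j a : ℕ) (ρ : Matrix (Fin n → Bool) (Fin n → Bool) ℂ) :
    Matrix ((Fin j × Fin n) ⊕ Fin a → Bool) ((Fin j × Fin n) ⊕ Fin a → Bool) ℂ :=
  Matrix.of fun x y =>
    if (∀ i, x (Sum.inr i) = false) ∧ (∀ i, y (Sum.inr i) = false) then
      ∏ c : Fin j, ρ (fun q => x (Sum.inl (c, q))) (fun q => y (Sum.inl (c, q)))
    else 0

/-! ### The output probabilities form a probability distribution -/

section Helpers

variable {W : Type} [Fintype W] [DecidableEq W]

theorem basisMap_unitary (f : (W → Bool) → (W → Bool)) (hf : Function.Injective f) :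
    (basisMap f)ᴴ * basisMap f = 1 := by
  ext x y
  simp [basisMap, Matrix.mul_apply, Matrix.one_apply, hf.eq_iff, apply_ite, eq_comm]

theorem flipIf_injective (a : W) (v : (W → Bool) → Bool)
    (hv : ∀ x b, v (Function.update x a b) = v x) : Function.Injective (flipIf a v) := by
  apply Function.LeftInverse.injective (g := flipIf a v)
  intro x
  simp [flipIf, hv]

theorem swapIf_injective (c a b : W) (hca : c ≠ a) (hcb : c ≠ b) :
    Function.Injective (swapIf c a b) := by
  apply Function.LeftInverse.injective (g := swapIf c a b)
  intro x
  by_cases h : x c = true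
  · simp [swapIf, h, Equiv.swap_apply_of_ne_of_ne hca hcb, Function.comp_assoc,
      ← Equiv.coe_trans]
  · simp [swapIf, h]

theorem hadamard_unitary (a : W) :
    (Gate.hadamard a).matrixᴴ * (Gate.hadamard a).matrix = 1 := by
  have hs : ((Real.sqrt 2 : ℝ) : ℂ) * ((Real.sqrt 2 : ℝ) : ℂ) = 2 := by
    rw [← Complex.ofReal_mul, Real.mul_self_sqrt (by norm_num)]; norm_num
  have hs0 : ((Real.sqrt 2 : ℝ) : ℂ) ≠ 0 := by
    intro h; rw [h] at hs; norm_num at hs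
  ext x z
  rw [Matrix.mul_apply, Fintype.sum_eq_add (Function.update x a false) (Function.update x a true)]
  · have hf : ∀ b : Bool, ∀ u : W → Bool,
        (∀ w, w ≠ a → Function.update x a b w = u w) ↔ (∀ w, w ≠ a → x w = u w) := by
      intro b u
      refine forall_congr' fun w => imp_congr_right fun hw => ?_
      rw [Function.update_of_ne hw]
    simp only [Matrix.conjTranspose_apply, Gate.matrix, Matrix.of_apply, hf,
      Function.update_self]
    by_cases h : ∀ w, w ≠ a → x w = z w
    · by_cases ha : x a = z a
      · have hxz : x = z := by
          funext w
          by_cases hw : w = a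
          · rw [hw, ha]
          · exact h w hw
        subst hxz
        cases x a <;> simp <;> field_simp <;> rw [sq, hs] <;> norm_num
      · have hxz : x ≠ z := fun e => ha (by rw [e])
        cases hx : x a <;> cases hz : z a <;> simp_all <;> ring
    · have hxz : x ≠ z := fun e => h (by simp [e])
      simp [h, hxz]
  · intro e
    have := congrFun e a
    simp at this
  · rintro y ⟨h0, h1⟩
    have hy : ¬ ∀ w, w ≠ a → y w = x w := by
      intro h
      have : y = Function.update x a (y a) := by
        funext w
        by_cases hw : w = a
        · subst hw; simp
        · rw [Function.update_of_ne hw, h w hw]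
      cases hya : y a
      · exact h0 (by rw [← hya]; exact this)
      · exact h1 (by rw [← hya]; exact this)
    simp [Gate.matrix, hy]

theorem Gate.unitary (g : Gate W) : g.matrixᴴ * g.matrix = 1 := by
  cases g with
  | hadamard a => exact hadamard_unitary a
  | pauliX a => exact basisMap_unitary _ (flipIf_injective a _ fun _ _ => rfl)
  | cnot c a h =>
    exact basisMap_unitary _ (flipIf_injective a _ fun _ _ => Function.update_of_ne h _ _)
  | cswap c a b h h' _ => exact basisMap_unitary _ (swapIf_injective c a b h h')

theorem Layer.unitary (L : Layer W) : L.matrixᴴ * L.matrix = 1 := by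
  unfold Layer.matrix
  induction L.gates with
  | nil => simp
  | cons g l ih =>
    rw [List.map_cons, List.prod_cons, Matrix.conjTranspose_mul, Matrix.mul_assoc,
      ← Matrix.mul_assoc _ g.matrix, g.unitary, Matrix.one_mul, ih]

theorem sum_measProj (M : Finset W) :
    ∑ o : M → Bool, (measProj M o)ᴴ * measProj M o = 1 := by
  have h : ∀ o : M → Bool, (measProj M o)ᴴ * measProj M o =
      Matrix.diagonal fun x : W → Bool => if o = (fun w : M => x w) then (1 : ℂ) else 0 := by
    intro o
    rw [measProj, Matrix.diagonal_conjTranspose, Matrix.diagonal_mul_diagonal]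
    congr 1
    funext x
    by_cases hx : ∀ w : M, x w = o w
    · have : o = fun w : M => x w := funext fun w => (hx w).symm
      simp only [Pi.star_apply, if_pos hx, if_pos this, star_one, mul_one]
    · have : o ≠ fun w : M => x w := fun e => hx fun w => by rw [e]
      simp only [Pi.star_apply, if_neg hx, if_neg this, mul_zero]
  simp only [h]
  ext x y
  rw [Matrix.sum_apply]
  by_cases hxy : x = y
  · subst hxy; simp
  · simp [hxy]

theorem sum_trace_postState (L : Layer W) (M : Finset W) (σ : Matrix (W → Bool) (W → Bool) ℂ) :
    ∑ o : M → Bool, (postState L M o σ).trace = σ.trace := by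
  have h : ∀ o : M → Bool, (postState L M o σ).trace =
      (L.matrixᴴ * ((measProj M o)ᴴ * measProj M o) * L.matrix * σ).trace := by
    intro o
    rw [postState, Matrix.trace_mul_comm, Matrix.conjTranspose_mul]
    simp only [Matrix.mul_assoc]
  simp only [h]
  rw [← Matrix.trace_sum, ← Finset.sum_mul, ← Finset.sum_mul, ← Finset.mul_sum, sum_measProj,
    Matrix.mul_one, L.unitary, Matrix.one_mul]

theorem Prog.prob_nonneg (p : Prog W) {σ : Matrix (W → Bool) (W → Bool) ℂ} (hσ : σ.PosSemidef)
    (b : Bool) : 0 ≤ p.prob σ b := by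
  induction p generalizing σ with
  | halt out =>
    unfold Prog.prob
    split_ifs
    · exact (Complex.nonneg_iff.1 hσ.trace_nonneg).1
    · exact le_rfl
  | round L M next ih =>
    unfold Prog.prob
    exact Finset.sum_nonneg fun o _ => ih o (hσ.mul_mul_conjTranspose_same _)

theorem Prog.prob_sum (p : Prog W) (σ : Matrix (W → Bool) (W → Bool) ℂ) :
    ∑ b : Bool, p.prob σ b = σ.trace.re := by
  induction p generalizing σ with
  | halt out => simp [Prog.prob]
  | round L M next ih =>
    simp only [Prog.prob]
    rw [Finset.sum_comm]
    simp only [ih]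
    rw [← Complex.re_sum, sum_trace_postState]

end Helpers

theorem inputState_posSemidef {n : ℕ} (j a : ℕ) {ρ : Matrix (Fin n → Bool) (Fin n → Bool) ℂ}
    (hρ : ρ.PosSemidef) : (inputState j a ρ).PosSemidef := by
  obtain ⟨B, rfl⟩ : ∃ B : Matrix (Fin n → Bool) (Fin n → Bool) ℂ, ρ = Bᴴ * B := by
    open scoped MatrixOrder in
    exact CStarAlgebra.nonneg_iff_eq_star_mul_self.mp hρ.nonneg
  have : inputState j a (Bᴴ * B) =
      (Matrix.of fun (z : Fin j → Fin n → Bool) (x : (Fin j × Fin n) ⊕ Fin a → Bool) =>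
        if ∀ i, x (Sum.inr i) = false then ∏ c, B (z c) (fun q => x (Sum.inl (c, q))) else 0)ᴴ *
      (Matrix.of fun (z : Fin j → Fin n → Bool) (x : (Fin j × Fin n) ⊕ Fin a → Bool) =>
        if ∀ i, x (Sum.inr i) = false then ∏ c, B (z c) (fun q => x (Sum.inl (c, q))) else 0) := by
    ext x y
    by_cases hx : ∀ i, x (Sum.inr i) = false
    · by_cases hy : ∀ i, y (Sum.inr i) = false
      · simp only [inputState, Matrix.mul_apply, Matrix.conjTranspose_apply, Matrix.of_apply,
          if_pos hx, if_pos hy, if_pos (And.intro hx hy), star_prod, ← Finset.prod_mul_distrib]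
        rw [Finset.prod_univ_sum, Fintype.piFinset_univ]
      · have : ¬ ((∀ i, x (Sum.inr i) = false) ∧ ∀ i, y (Sum.inr i) = false) := fun h => hy h.2
        simp only [inputState, Matrix.mul_apply, Matrix.conjTranspose_apply, Matrix.of_apply,
          if_neg hy, if_neg this, mul_zero, Finset.sum_const_zero]
    · have : ¬ ((∀ i, x (Sum.inr i) = false) ∧ ∀ i, y (Sum.inr i) = false) := fun h => hx h.1
      simp only [inputState, Matrix.mul_apply, Matrix.conjTranspose_apply, Matrix.of_apply,
          if_neg hx, if_neg this, star_zero, zero_mul, Finset.sum_const_zero]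
  rw [this]
  exact Matrix.posSemidef_conjTranspose_mul_self _

theorem inputState_trace {n : ℕ} (j a : ℕ) (ρ : Matrix (Fin n → Bool) (Fin n → Bool) ℂ) :
    (inputState j a ρ).trace = ρ.trace ^ j := by
  unfold Matrix.trace
  rw [← Equiv.sum_comp ((Equiv.sumArrowEquivProdArrow (Fin j × Fin n) (Fin a) Bool).symm),
    Fintype.sum_prod_type, ← Equiv.sum_comp (Equiv.curry (Fin j) (Fin n) Bool).symm]
  have h : ∀ (x : Fin j → Fin n → Bool) (y : Fin a → Bool),
      (inputState j a ρ).diag ((Equiv.sumArrowEquivProdArrow (Fin j × Fin n) (Fin a) Bool).symm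
        ((Equiv.curry (Fin j) (Fin n) Bool).symm x, y)) =
      if y = fun _ => false then ∏ c, ρ.diag (x c) else 0 := by
    intro x y
    simp [inputState, Equiv.sumArrowEquivProdArrow, funext_iff, Function.uncurry]
  simp only [h, Finset.sum_ite_eq', Finset.mem_univ, if_true]
  rw [← Fintype.piFinset_univ, ← Finset.prod_univ_sum]
  simp

/-- The distribution of the output bit of one run of the circuit on `j` copies of `ρ`. -/
def Circuit.law {n j : ℕ} (C : Circuit n j) (ρ : QState (Fin n → Bool)) : PMF Bool :=
  PMF.ofFintype (fun b => ENNReal.ofReal (C.prog.prob (inputState j C.ancillas ρ.mat) b)) (by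
    rw [← ENNReal.ofReal_sum_of_nonneg fun b _ =>
        C.prog.prob_nonneg (inputState_posSemidef j _ ρ.posSemidef) b,
      Prog.prob_sum, inputState_trace, ρ.trace_eq_one]
    simp)

/-- The joint distribution of independent runs: `N` runs of the circuit `circ j` on `j` copies
of `ρ`, for each `j = 1, …, t` (the index `s : Fin t` stands for `j = s + 1`). -/
def runsMeasure {n : ℕ} (circ : ∀ j, Circuit n j) (ρ : QState (Fin n → Bool)) (t N : ℕ) :
    MeasureTheory.Measure (Fin t × Fin N → Bool) :=
  MeasureTheory.Measure.pi fun s => ((circ (s.1 + 1)).law ρ).toMeasure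

/-- The estimate of `Tr(ρ^j)`, for `1 ≤ j ≤ t`: the mean of `(-1)^(output bit)` over the `N` runs
of the circuit for `j`. -/
def estimate {t N : ℕ} (ω : Fin t × Fin N → Bool) (j : ℕ) : ℂ :=
  if h : 1 ≤ j ∧ j ≤ t then
    (∑ m : Fin N, if ω (⟨j - 1, by omega⟩, m) then (-1 : ℂ) else 1) / N
  else 0

/-- The cutoff `⌊ln(2k/ε)⌋`. -/
def cutoff (k : ℕ) (ε : ℝ) : ℕ := ⌊Real.log (2 * k / ε)⌋₊

/-- The accuracy `ε / (2 k t ln t)`, `t = ⌊ln(2k/ε)⌋`, demanded of the estimates of `Tr(ρ^j)`,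
`1 ≤ j ≤ t`. -/
def accuracy (k : ℕ) (ε : ℝ) : ℝ :=
  ε / (2 * k * cutoff k ε * Real.log (cutoff k ε))

end

/-! Part (1). Let x run through the eigenvalues of ρ, which are nonnegative with sum 1. Put P = ∏ (1
- xX) and H = 1/P, and let p be the series of the power sums. Newton's identities read X P' = -P p.
The recursion for b_m says the same of U = ∑ (-1)^m b_m X^m, namely X U' = -U Q. The extrapolation
beyond t is exactly the rule that makes the truncation F of U at degree t satisfy X F' = -F Q̂,
where Q̂ is the extended sequence. Hence c = U H and F H satisfy X c' = c (p - Q) and X (F H)' = F H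
(p - Q̂), and the errors on both sides become logarithmic derivatives.

If |p_i - Q_i| ≤ η ≤ 1 for i ≤ t, then |c_r| ≤ η for 1 ≤ r ≤ t (`norm_coeff_le_of_derivative`).
Since U = P c, the series F H is the sum over r ≤ t of c_r X^r times (P truncated at degree t - r)
times H. The coefficients of such truncated products are hook Schur functions up to sign. Hooks of
adjacent leg length have opposite signs here and differ by ± e_q h_N, so each is at most e_q h_N ≤
1/q! (`abs_hookCoeff_le`). All nonconstant coefficients of F H are therefore bounded by some κ of
size about 1/(t+1)! + O(η), and passing back to the logarithmic derivative gives an error of at most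
(1+κ)^i - 1 (`norm_newtonPower_sub_le`). As k < ε e^(t+1)/2, the choice of t makes kκ ≤ 0.69 ε, and
e^(0.69 ε) - 1 < ε.

Part (2). Tr(ρ^j) is the expectation of the cyclic shift of the copies in ρ^⊗j. The shift is a
product of two reflections, each a product of disjoint transpositions, so a controlled shift takes
two layers of CSWAPs once every data qubit has its own control. The controls have to be in a GHZ
state. This is prepared in constant depth by putting all controls in |+⟩, measuring the parities of
cyclic neighbours and correcting with Pauli X gates. Measuring all controls in the Hadamard basis
and outputting the parity completes a Hadamard test with expectation Tr(ρ^j) (`shiftProg_expect`,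
`traceCircuit_expect`). Hoeffding's inequality and a union bound over j ≤ t give the number of runs.
-/

/-! ## Symmetric functions as power series -/

section SymmetricSeries

open PowerSeries

/-- The power series `∏ (1 - x X)` of the elementary symmetric functions, up to signs. -/
noncomputable def elemSeries {R : Type*} [CommRing R] (l : List R) : R⟦X⟧ :=
  (l.map fun x => 1 - C x * X).prod

/-- The generating series `∏ ∑ x ^ n X ^ n` of the complete symmetric functions. -/
noncomputable def complSeries {R : Type*} [CommRing R] (l : List R) : R⟦X⟧ :=
  (l.map fun x => mk fun n => x ^ n).prod

/-- The generating series of the power sums with positive exponents. -/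
noncomputable def powerSumSeries {R : Type*} [CommRing R] (l : List R) : R⟦X⟧ :=
  mk fun n => if n = 0 then 0 else (l.map fun x => x ^ n).sum

section Ring

variable {R : Type*} [CommRing R]

theorem one_sub_mul_geometric (x : R) : (1 - C x * X) * (mk fun n => x ^ n) = (1 : R⟦X⟧) := by
  ext n
  rw [sub_mul, one_mul, mul_assoc, map_sub, coeff_C_mul]
  cases n with
  | zero => simp
  | succ n => rw [coeff_succ_X_mul]; simp [pow_succ', coeff_one]

theorem elemSeries_cons (x : R) (l : List R) :
    elemSeries (x :: l) = (1 - C x * X) * elemSeries l := by simp [elemSeries]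

theorem complSeries_cons (x : R) (l : List R) :
    (1 - C x * X) * complSeries (x :: l) = complSeries l := by
  rw [complSeries, List.map_cons, List.prod_cons, ← mul_assoc, one_sub_mul_geometric, one_mul,
    complSeries]

theorem elemSeries_mul_complSeries (l : List R) : elemSeries l * complSeries l = 1 := by
  induction l with
  | nil => simp [elemSeries, complSeries]
  | cons x l ih => rw [elemSeries_cons, mul_comm _ (elemSeries l), mul_assoc, complSeries_cons, ih]

theorem powerSumSeries_cons (x : R) (l : List R) :
    powerSumSeries (x :: l) = ((mk fun n => x ^ n) - 1) + powerSumSeries l := by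
  ext n
  by_cases h : n = 0 <;> simp [powerSumSeries, coeff_one, h]

/-- Newton's identities for all degrees at once. By the product rule each factor 1 - xX contributes
-xX/(1 - xX), the geometric series without its constant term, to X P'/P. -/
theorem X_mul_derivative_elemSeries (l : List R) :
    X * d⁄dX R (elemSeries l) = -(elemSeries l * powerSumSeries l) := by
  induction l with
  | nil =>
    have : powerSumSeries ([] : List R) = 0 := by ext n; simp [powerSumSeries]
    simp [elemSeries, this]
  | cons x l ih =>
    rw [elemSeries_cons, powerSumSeries_cons, Derivation.leibniz]
    have h := one_sub_mul_geometric x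
    have hd : d⁄dX R (1 - C x * X : R⟦X⟧) = - C x := by
      simp [Derivation.leibniz]
    rw [hd]
    simp only [smul_eq_mul]
    linear_combination (1 - C x * X) * ih + elemSeries l * h

theorem coeff_succ_elemSeries_cons (x : R) (l : List R) (m : ℕ) :
    coeff (m + 1) (elemSeries (x :: l)) =
      coeff (m + 1) (elemSeries l) - x * coeff m (elemSeries l) := by
  rw [elemSeries_cons, sub_mul, one_mul, mul_assoc, map_sub, coeff_C_mul, coeff_succ_X_mul]

theorem coeff_succ_complSeries_cons (x : R) (l : List R) (m : ℕ) :
    coeff (m + 1) (complSeries (x :: l)) =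
      coeff (m + 1) (complSeries l) + x * coeff m (complSeries (x :: l)) := by
  rw [← complSeries_cons x l, sub_mul, one_mul, mul_assoc, map_sub, coeff_C_mul, coeff_succ_X_mul]
  ring

theorem constantCoeff_elemSeries (l : List R) : coeff 0 (elemSeries l) = 1 := by
  induction l with
  | nil => simp [elemSeries]
  | cons x l ih => rw [coeff_zero_eq_constantCoeff_apply] at *; simp [elemSeries_cons, ih]

theorem constantCoeff_complSeries (l : List R) : coeff 0 (complSeries l) = 1 := by
  have := congrArg (coeff 0) (elemSeries_mul_complSeries l)
  rw [coeff_zero_eq_constantCoeff_apply, map_mul, ← coeff_zero_eq_constantCoeff_apply,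
    constantCoeff_elemSeries] at this
  simpa using this

/-- Up to sign, the hook Schur functions. -/
noncomputable def hookCoeff (l : List R) (N q : ℕ) : R :=
  coeff N (((trunc q (elemSeries l) : Polynomial R) : R⟦X⟧) * complSeries l)

theorem hookCoeff_zero_left (l : List R) (q : ℕ) : hookCoeff l 0 (q + 1) = 1 := by
  rw [hookCoeff, coeff_zero_eq_constantCoeff_apply, map_mul, ← coeff_zero_eq_constantCoeff_apply,
    ← coeff_zero_eq_constantCoeff_apply, constantCoeff_complSeries, Polynomial.coeff_coe, coeff_trunc,
    constantCoeff_elemSeries]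
  simp

theorem hookCoeff_zero_right (l : List R) (N : ℕ) : hookCoeff l N 0 = 0 := by
  simp [hookCoeff]

/-- Below degree q the truncation is invisible, and P H = 1 has no coefficients of positive degree.
-/
theorem hookCoeff_eq_zero (l : List R) {N q : ℕ} (h0 : N ≠ 0) (h : N < q) :
    hookCoeff l N q = 0 := by
  have h1 : coeff N (elemSeries l * complSeries l) = 0 := by
    rw [elemSeries_mul_complSeries, coeff_one, if_neg h0]
  rw [← h1, hookCoeff, coeff_mul, coeff_mul]
  refine Finset.sum_congr rfl fun p hp => ?_
  have hp' := Finset.HasAntidiagonal.mem_antidiagonal.1 hp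
  rw [coeff_coe_trunc_of_lt (by omega)]

/-- Pieri's rule: up to signs, e_q h_N is the sum of two hooks. Together with the signs of the hooks
it bounds each of them by the product. -/
theorem hookCoeff_succ_right (l : List R) (N q : ℕ) :
    hookCoeff l (N + q) (q + 1) =
      hookCoeff l (N + q) q + coeff q (elemSeries l) * coeff N (complSeries l) := by
  have : ((trunc (q + 1) (elemSeries l) : Polynomial R) : R⟦X⟧) =
      ((trunc q (elemSeries l) : Polynomial R) : R⟦X⟧) + C (coeff q (elemSeries l)) * X ^ q := by
    rw [trunc_succ, Polynomial.coe_add, Polynomial.coe_monomial, monomial_eq_C_mul_X_pow]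
  rw [hookCoeff, this, add_mul, map_add, mul_assoc, coeff_C_mul, coeff_X_pow_mul, hookCoeff]

theorem trunc_succ_one_sub_mul (x : R) (f : R⟦X⟧) (q : ℕ) :
    ((trunc (q + 1) ((1 - C x * X) * f) : Polynomial R) : R⟦X⟧) =
      ((trunc (q + 1) f : Polynomial R) : R⟦X⟧) -
        C x * X * ((trunc q f : Polynomial R) : R⟦X⟧) := by
  ext n
  rw [map_sub, mul_assoc, coeff_C_mul, Polynomial.coeff_coe, Polynomial.coeff_coe, coeff_trunc,
    coeff_trunc, sub_mul, one_mul, map_sub, mul_assoc, coeff_C_mul]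
  cases n with
  | zero => simp
  | succ n =>
    rw [coeff_succ_X_mul, coeff_succ_X_mul, Polynomial.coeff_coe, coeff_trunc]
    by_cases h : n < q <;> simp [h]

/-- Multiplication by 1 - xX removes x from H, while P for the longer list contains this factor;
moving it out of the truncation lowers the cutoff of its X-part by one. With the expected signs
(-1)^(q-1) of hooks, all three terms on the right have the same sign, which is what makes an
induction possible. -/
theorem hookCoeff_cons (x : R) (l : List R) (N q : ℕ) :
    hookCoeff (x :: l) (N + 1) (q + 1) =
      x * hookCoeff (x :: l) N (q + 1) + hookCoeff l (N + 1) (q + 1) - x * hookCoeff l N q := by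
  have h : (1 - C x * X) * (((trunc (q + 1) (elemSeries (x :: l)) : Polynomial R) : R⟦X⟧) * complSeries (x :: l)) =
      ((trunc (q + 1) (elemSeries l) : Polynomial R) : R⟦X⟧) * complSeries l
        - C x * (X * (((trunc q (elemSeries l) : Polynomial R) : R⟦X⟧) * complSeries l)) := by
    rw [mul_left_comm, complSeries_cons, elemSeries_cons, trunc_succ_one_sub_mul]
    ring
  have := congrArg (coeff (N + 1)) h
  rw [sub_mul, one_mul, mul_assoc, map_sub, map_sub, coeff_C_mul, coeff_C_mul, coeff_succ_X_mul,
    coeff_succ_X_mul] at this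
  simp only [hookCoeff]
  linear_combination this

end Ring

/-- Positivity of the hook Schur functions. -/
theorem hookCoeff_sign (l : List ℝ) (hl : ∀ x ∈ l, 0 ≤ x) (N q : ℕ) :
    0 ≤ (-1) ^ q * hookCoeff l (N + 1) (q + 1) := by
  induction l generalizing N q with
  | nil =>
    have : hookCoeff ([] : List ℝ) (N + 1) (q + 1) = 0 := by
      simp [hookCoeff, elemSeries, complSeries, coeff_one]
    simp [this]
  | cons x l ih =>
    have hx : 0 ≤ x := hl x (by simp)
    have ih' := fun N q => ih (fun y hy => hl y (by simp [hy])) N q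
    induction N generalizing q with
    | zero =>
      -- In degree 0 the coefficient is 1 for every positive cutoff, so the sign pattern fails
      -- there. The two terms with x cancel, except for q = 0, where the subtracted one is absent.
      rw [hookCoeff_cons, hookCoeff_zero_left]
      have h1 := ih' 0 q
      cases q with
      | zero =>
        rw [hookCoeff_zero_right]
        simp only [pow_zero, one_mul] at *
        linarith
      | succ q =>
        rw [hookCoeff_zero_left]
        have : x * 1 + hookCoeff l (0 + 1) (q + 1 + 1) - x * 1 = hookCoeff l (0 + 1) (q + 1 + 1) := by
          ring
        rw [this]
        exact h1
    | succ N ihN =>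
      rw [hookCoeff_cons]
      have h1 := ih' (N + 1) q
      have h2 := mul_nonneg hx (ihN q)
      cases q with
      | zero =>
        rw [hookCoeff_zero_right]
        simp only [pow_zero, one_mul] at *
        linarith
      | succ q =>
        have h3 := mul_nonneg hx (ih' N q)
        rw [pow_succ] at h1 h2 ⊢
        nlinarith

/-- The first two terms of the binomial expansion. Divided by (m+1)!, this is the induction step of
e_m ≤ s^m / m! when a variable x is added to variables of sum s. -/
theorem pow_add_succ_mul_le {x s : ℝ} (hx : 0 ≤ x) (hs : 0 ≤ s) (m : ℕ) :
    s ^ (m + 1) + (m + 1) * (x * s ^ m) ≤ (x + s) ^ (m + 1) := by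
  induction m with
  | zero => simp [add_comm]
  | succ m ih =>
    have h := mul_le_mul_of_nonneg_right ih (add_nonneg hx hs)
    have h2 : 0 ≤ ((m : ℝ) + 1) * (x ^ 2 * s ^ m) := by positivity
    rw [pow_succ (x + s)]
    push_cast
    refine le_trans ?_ h
    rw [pow_succ s (m + 1), pow_succ s m]
    nlinarith

theorem coeff_elemSeries_bounds (l : List ℝ) (hl : ∀ x ∈ l, 0 ≤ x) (m : ℕ) :
    0 ≤ (-1) ^ m * coeff m (elemSeries l) ∧
      (-1) ^ m * coeff m (elemSeries l) ≤ l.sum ^ m / m.factorial := by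
  induction l generalizing m with
  | nil => cases m <;> simp [elemSeries, coeff_one]
  | cons x l ih =>
    have hx : 0 ≤ x := hl x (by simp)
    have hl' : ∀ y ∈ l, 0 ≤ y := fun y hy => hl y (by simp [hy])
    have ih' := ih hl'
    have hs : 0 ≤ l.sum := List.sum_nonneg hl'
    cases m with
    | zero => rw [constantCoeff_elemSeries]; simp
    | succ m =>
      rw [coeff_succ_elemSeries_cons, List.sum_cons]
      obtain ⟨a1, a2⟩ := ih' (m + 1)
      obtain ⟨b1, b2⟩ := ih' m
      have e : (-1 : ℝ) ^ (m + 1) * (coeff (m + 1) (elemSeries l) - x * coeff m (elemSeries l)) =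
          (-1) ^ (m + 1) * coeff (m + 1) (elemSeries l) +
            x * ((-1) ^ m * coeff m (elemSeries l)) := by ring
      rw [e]
      refine ⟨by positivity, (add_le_add a2 (mul_le_mul_of_nonneg_left b2 hx)).trans ?_⟩
      have hp : l.sum ^ (m + 1) + (m + 1) * (x * l.sum ^ m) ≤ (x + l.sum) ^ (m + 1) :=
        pow_add_succ_mul_le hx hs m
      rw [Nat.factorial_succ]
      push_cast
      rw [le_div_iff₀ (by positivity)]
      have hf : (m.factorial : ℝ) ≠ 0 := by positivity
      field_simp
      nlinarith

theorem coeff_complSeries_bounds (l : List ℝ) (hl : ∀ x ∈ l, 0 ≤ x) (n : ℕ) :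
    0 ≤ coeff n (complSeries l) ∧ coeff n (complSeries l) ≤ l.sum ^ n := by
  induction l generalizing n with
  | nil => cases n <;> simp [complSeries, coeff_one]
  | cons x l ih =>
    have hx : 0 ≤ x := hl x (by simp)
    have hl' : ∀ y ∈ l, 0 ≤ y := fun y hy => hl y (by simp [hy])
    have ih' := ih hl'
    have hs : 0 ≤ l.sum := List.sum_nonneg hl'
    induction n with
    | zero => rw [constantCoeff_complSeries]; simp
    | succ n ihn =>
      rw [coeff_succ_complSeries_cons]
      rw [List.sum_cons] at *
      obtain ⟨a1, a2⟩ := ih' (n + 1)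
      obtain ⟨b1, b2⟩ := ihn
      refine ⟨by positivity, (add_le_add a2 (mul_le_mul_of_nonneg_left b2 hx)).trans ?_⟩
      have : l.sum ^ n ≤ (x + l.sum) ^ n := by gcongr; linarith
      rw [pow_succ, pow_succ]
      nlinarith

/-- The coefficients for the cutoffs q + 1 and q + 2 have opposite signs and differ by ± e_(q+1)
h_M, so each is bounded by this product. Variables of sum 1 have e_(q+1) ≤ 1/(q+1)! and h_M ≤ 1. -/
theorem abs_hookCoeff_le (l : List ℝ) (hl : ∀ x ∈ l, 0 ≤ x) (hs : l.sum = 1) {N q : ℕ}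
    (h : q < N) : |hookCoeff l N (q + 1)| ≤ 1 / (q + 1).factorial := by
  obtain ⟨M, rfl⟩ : ∃ M, N = M + (q + 1) := ⟨N - (q + 1), by omega⟩
  have h1 := hookCoeff_sign l hl (M + q) q
  have h2 := hookCoeff_sign l hl (M + q) (q + 1)
  have h3 := hookCoeff_succ_right l M (q + 1)
  obtain ⟨a1, a2⟩ := coeff_elemSeries_bounds l hl (q + 1)
  obtain ⟨b1, b2⟩ := coeff_complSeries_bounds l hl M
  rw [hs, one_pow] at a2 b2
  rw [← add_assoc] at *
  have h4 : (-1) ^ q * hookCoeff l (M + q + 1) (q + 1) ≤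
      ((-1) ^ (q + 1) * coeff (q + 1) (elemSeries l)) * coeff M (complSeries l) := by
    rw [h3, pow_succ] at h2
    rw [pow_succ]
    linarith
  have h5 := h4.trans (mul_le_mul a2 b2 b1 (by positivity))
  calc |hookCoeff l (M + q + 1) (q + 1)|
      = |(-1) ^ q * hookCoeff l (M + q + 1) (q + 1)| := by simp [abs_mul]
    _ = (-1) ^ q * hookCoeff l (M + q + 1) (q + 1) := abs_of_nonneg h1
    _ ≤ _ := by rwa [mul_one] at h5

section Map

variable {R S : Type*} [CommRing R] [CommRing S] (f : R →+* S)

theorem map_elemSeries (l : List R) : (elemSeries l).map f = elemSeries (l.map f) := by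
  simp [elemSeries, map_list_prod, Function.comp_def]

theorem map_complSeries (l : List R) : (complSeries l).map f = complSeries (l.map f) := by
  rw [complSeries, map_list_prod, complSeries, List.map_map, List.map_map]
  congr 1
  refine List.map_congr_left fun x _ => ?_
  ext n
  simp

/-- The hook bounds rest on positivity over ℝ, but the estimates Q are complex; this carries the
bounds over. -/
theorem map_hookCoeff (l : List R) (N q : ℕ) :
    f (hookCoeff l N q) = hookCoeff (l.map f) N q := by
  rw [hookCoeff, hookCoeff, ← map_elemSeries, ← map_complSeries, trunc_map,
    Polynomial.polynomial_map_coe, ← map_mul, coeff_map]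

end Map

end SymmetricSeries

/-! ## Stability of the Newton-Girard extrapolation -/

section Newton

open PowerSeries

/-- The power series with coefficients `f n` for `n ≥ 1` and no constant term. -/
noncomputable def positiveSeries (f : ℕ → ℂ) : ℂ⟦X⟧ := mk fun n => if n = 0 then 0 else f n

theorem coeff_positiveSeries_zero (f : ℕ → ℂ) : coeff 0 (positiveSeries f) = 0 := by
  simp [positiveSeries]

theorem coeff_positiveSeries {f : ℕ → ℂ} {n : ℕ} (h : n ≠ 0) :
    coeff n (positiveSeries f) = f n := by
  simp [positiveSeries, h]

/-- The power series `∑ (-1) ^ m b_m X ^ m`. -/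
noncomputable def newtonSeries (Q : ℕ → ℂ) : ℂ⟦X⟧ := mk fun m => (-1) ^ m * newtonElem Q m

theorem coeff_X_mul_derivative (f : ℂ⟦X⟧) (n : ℕ) :
    coeff n (X * d⁄dX ℂ f) = n * coeff n f := by
  cases n with
  | zero => simp
  | succ n => rw [coeff_succ_X_mul, coeff_derivative]; push_cast; ring

theorem coeff_succ_mul_of_coeff_zero {f s : ℂ⟦X⟧} (hs : coeff 0 s = 0) (n : ℕ) :
    coeff (n + 1) (f * s) = ∑ i ∈ Finset.range (n + 1), coeff i f * coeff (n + 1 - i) s := by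
  rw [coeff_mul, Finset.Nat.sum_antidiagonal_eq_sum_range_succ
    (fun i j => coeff i f * coeff j s), Finset.sum_range_succ, Nat.sub_self, hs]
  simp

theorem newtonElem_succ_mul (Q : ℕ → ℂ) (m : ℕ) :
    ((m : ℂ) + 1) * newtonElem Q (m + 1) =
      ∑ i ∈ Finset.range (m + 1), (-1) ^ (m - i) * newtonElem Q i * Q (m + 1 - i) := by
  have h : ((m : ℂ) + 1) ≠ 0 := by exact_mod_cast Nat.succ_ne_zero m
  rw [newtonElem, ← mul_assoc, mul_one_div_cancel h, one_mul,
    Fin.sum_univ_eq_sum_range (fun i => (-1) ^ i * newtonElem Q (m - i) * Q (i + 1)),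
    ← Finset.sum_range_reflect]
  refine Finset.sum_congr rfl fun i hi => ?_
  have hi' := Finset.mem_range.1 hi
  rw [show m + 1 - 1 - i = m - i by omega, show m - (m - i) = i by omega,
    show m - i + 1 = m + 1 - i by omega]

/-- The recursion defining b_m is Newton's identity solved for b_m, so it holds for arbitrary Q,
whether or not these are power sums. -/
theorem X_mul_derivative_newtonSeries (Q : ℕ → ℂ) :
    X * d⁄dX ℂ (newtonSeries Q) = -(newtonSeries Q * positiveSeries Q) := by
  ext n
  rw [coeff_X_mul_derivative, map_neg]
  cases n with
  | zero => simp [positiveSeries]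
  | succ n =>
    rw [coeff_succ_mul_of_coeff_zero (coeff_positiveSeries_zero Q)]
    simp only [newtonSeries, coeff_mk]
    push_cast
    rw [mul_left_comm, newtonElem_succ_mul, Finset.mul_sum, ← Finset.sum_neg_distrib]
    refine Finset.sum_congr rfl fun i hi => ?_
    have hi' := Finset.mem_range.1 hi
    rw [coeff_positiveSeries (by omega)]
    obtain ⟨a, rfl⟩ : ∃ a, n = i + a := ⟨n - i, by omega⟩
    rw [Nat.add_sub_cancel_left]
    have : (-1 : ℂ) ^ a * (-1) ^ a = 1 := by rw [← mul_pow]; simp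
    rw [pow_succ, pow_add]
    linear_combination (-(-1) ^ i * newtonElem Q i * Q (i + a + 1 - i)) * this

theorem newtonPower_of_le {Q : ℕ → ℂ} {t l : ℕ} (h : l ≤ t) : newtonPower Q t l = Q l := by
  rw [newtonPower, if_pos h]

theorem newtonPower_of_lt {Q : ℕ → ℂ} {t l : ℕ} (h : t < l) :
    newtonPower Q t l =
      ∑ j ∈ Finset.range t, (-1) ^ j * newtonElem Q (j + 1) * newtonPower Q t (l - (j + 1)) := by
  rw [newtonPower, if_neg (by omega)]
  exact Fin.sum_univ_eq_sum_range
    (fun j => (-1) ^ j * newtonElem Q (j + 1) * newtonPower Q t (l - (j + 1))) t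

/-- Up to degree t this is the identity for the untruncated series. Beyond t the left side vanishes,
and the vanishing of the right side is the rule that defines `newtonPower`. -/
theorem X_mul_derivative_trunc_newtonSeries (Q : ℕ → ℂ) (t : ℕ) :
    X * d⁄dX ℂ ((trunc (t + 1) (newtonSeries Q) : Polynomial ℂ) : ℂ⟦X⟧) =
      -(((trunc (t + 1) (newtonSeries Q) : Polynomial ℂ) : ℂ⟦X⟧) *
        positiveSeries (newtonPower Q t)) := by
  ext n
  rw [coeff_X_mul_derivative, map_neg]
  cases n with
  | zero => simp [positiveSeries]
  | succ n =>
    rw [coeff_succ_mul_of_coeff_zero (coeff_positiveSeries_zero _)]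
    by_cases h : n + 1 ≤ t
    · have h1 := congrArg (coeff (n + 1)) (X_mul_derivative_newtonSeries Q)
      rw [coeff_X_mul_derivative, map_neg,
        coeff_succ_mul_of_coeff_zero (coeff_positiveSeries_zero _)] at h1
      rw [coeff_coe_trunc_of_lt (by omega), h1]
      congr 1
      refine Finset.sum_congr rfl fun i hi => ?_
      have hi' := Finset.mem_range.1 hi
      rw [coeff_coe_trunc_of_lt (by omega), coeff_positiveSeries (by omega),
        coeff_positiveSeries (by omega), newtonPower_of_le (by omega)]
    · have h0 : ∀ i, t < i → coeff i ((trunc (t + 1) (newtonSeries Q) : Polynomial ℂ) : ℂ⟦X⟧) = 0 := by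
        intro i hi
        rw [Polynomial.coeff_coe, coeff_trunc, if_neg (by omega)]
      rw [h0 _ (by omega), mul_zero, eq_comm, neg_eq_zero]
      rw [← Finset.sum_subset (Finset.range_subset_range.2 (show t + 1 ≤ n + 1 by omega))]
      · rw [Finset.sum_range_succ', coeff_positiveSeries (by omega), Nat.sub_zero,
          newtonPower_of_lt (by omega), coeff_coe_trunc_of_lt (by omega)]
        simp only [newtonSeries, coeff_mk, newtonElem, pow_zero, one_mul]
        rw [← Finset.sum_add_distrib]
        refine Finset.sum_eq_zero fun i hi => ?_
        have hi' := Finset.mem_range.1 hi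
        rw [coeff_coe_trunc_of_lt (by omega), coeff_positiveSeries (by omega), coeff_mk, pow_succ]
        simp only [newtonElem]
        ring
      · intro i _ hi
        rw [h0 i (by simpa using hi), zero_mul]

/-- Truncation of a product, sorted by the degree r taken from c: the factor P may then use only the
remaining t - r degrees. With H = 1/P the inner coefficients are values of `hookCoeff`. -/
theorem coeff_trunc_mul_mul {P c H : ℂ⟦X⟧} (t n : ℕ) :
    coeff n (((trunc (t + 1) (P * c) : Polynomial ℂ) : ℂ⟦X⟧) * H) =
      ∑ r ∈ Finset.range (t + 1), coeff r c * if r ≤ n then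
        coeff (n - r) (((trunc (t + 1 - r) P : Polynomial ℂ) : ℂ⟦X⟧) * H) else 0 := by
  have h : ((trunc (t + 1) (P * c) : Polynomial ℂ) : ℂ⟦X⟧) =
      ∑ r ∈ Finset.range (t + 1),
        C (coeff r c) * (X ^ r * ((trunc (t + 1 - r) P : Polynomial ℂ) : ℂ⟦X⟧)) := by
    ext m
    rw [map_sum]
    simp only [coeff_C_mul, coeff_X_pow_mul', Polynomial.coeff_coe, coeff_trunc]
    by_cases hm : m < t + 1
    · rw [if_pos hm, mul_comm P, coeff_mul, Finset.Nat.sum_antidiagonal_eq_sum_range_succ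
        (fun i j => coeff i c * coeff j P),
        ← Finset.sum_subset (Finset.range_subset_range.2 (show m + 1 ≤ t + 1 by omega))]
      · refine Finset.sum_congr rfl fun i hi => ?_
        have hi' := Finset.mem_range.1 hi
        rw [if_pos (by omega), if_pos (by omega)]
      · intro i _ hi
        rw [if_neg (by simp at hi; omega), mul_zero]
    · rw [if_neg hm, eq_comm]
      refine Finset.sum_eq_zero fun i hi => ?_
      have hi' := Finset.mem_range.1 hi
      by_cases him : i ≤ m
      · rw [if_pos him, if_neg (by omega), mul_zero]
      · rw [if_neg him, mul_zero]
  rw [h, Finset.sum_mul, map_sum]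
  refine Finset.sum_congr rfl fun r _ => ?_
  rw [mul_assoc, mul_assoc, coeff_C_mul, coeff_X_pow_mul']

/-- Coefficients of `exp ∫ s / X` for a series `s` with small coefficients. -/
theorem norm_coeff_le_of_derivative {c s : ℂ⟦X⟧} (hc : X * d⁄dX ℂ c = c * s)
    (h0 : coeff 0 c = 1) (hs0 : coeff 0 s = 0) {η : ℝ} (h1 : η ≤ 1) {t : ℕ}
    (hs : ∀ i, 1 ≤ i → i ≤ t → ‖coeff i s‖ ≤ η) (r : ℕ) (hr : r + 1 ≤ t) :
    ‖coeff (r + 1) c‖ ≤ η ∧ ((r : ℝ) + 1) * ‖coeff (r + 1) c‖ ≤ η * (1 + r * η) := by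
  have hη : 0 ≤ η := (norm_nonneg _).trans (hs 1 le_rfl (by omega))
  induction r using Nat.strong_induction_on with
  | _ r ih =>
    have h := congrArg (coeff (r + 1)) hc
    rw [coeff_X_mul_derivative, coeff_succ_mul_of_coeff_zero hs0] at h
    have h2 : ((r : ℝ) + 1) * ‖coeff (r + 1) c‖ ≤ η * (1 + r * η) := by
      calc ((r : ℝ) + 1) * ‖coeff (r + 1) c‖ = ‖((r + 1 : ℕ) : ℂ) * coeff (r + 1) c‖ := by
            rw [norm_mul, Complex.norm_natCast]; push_cast; rfl
        _ ≤ ∑ i ∈ Finset.range (r + 1), ‖coeff i c‖ * η := by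
            rw [h]
            refine (norm_sum_le _ _).trans (Finset.sum_le_sum fun i hi => ?_)
            have hi' := Finset.mem_range.1 hi
            rw [norm_mul]
            exact mul_le_mul_of_nonneg_left (hs _ (by omega) (by omega)) (norm_nonneg _)
        -- The term i = 0 has c_0 = 1; the others are bounded by η by induction. The second
        -- conclusion keeps the factor 1/(r+1), which is needed for the constant at t = 4.
        _ ≤ (∑ i ∈ Finset.range r, η * η) + 1 * η := by
            rw [Finset.sum_range_succ', h0, norm_one]
            gcongr with i hi
            have hi' := Finset.mem_range.1 hi
            exact (ih i hi' (by omega)).1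
        _ = η * (1 + r * η) := by simp; ring
    refine ⟨?_, h2⟩
    have h3 : η * (1 + r * η) ≤ ((r : ℝ) + 1) * η := by
      have : (r : ℝ) * η ≤ r := mul_le_of_le_one_right (Nat.cast_nonneg r) h1
      nlinarith
    exact le_of_mul_le_mul_left (h2.trans h3) (by positivity)

/-- Coefficients of `X f' / f` for a series `f` with small coefficients. -/
theorem norm_coeff_le_of_logDerivative {f s : ℂ⟦X⟧} (hf : X * d⁄dX ℂ f = f * s)
    (h0 : coeff 0 f = 1) (hs0 : coeff 0 s = 0) {κ : ℝ}
    (hκ : ∀ n, 1 ≤ n → ‖coeff n f‖ ≤ κ) (l : ℕ) :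
    ‖coeff l s‖ ≤ (1 + κ) ^ l - 1 := by
  have hκ0 : 0 ≤ κ := (norm_nonneg _).trans (hκ 1 le_rfl)
  induction l using Nat.strong_induction_on with
  | _ l ih =>
    cases l with
    | zero => simp [hs0]
    | succ l =>
      have h := congrArg (coeff (l + 1)) hf
      rw [coeff_X_mul_derivative, coeff_succ_mul_of_coeff_zero hs0, Finset.sum_range_succ', h0,
        one_mul, Nat.sub_zero] at h
      rw [eq_sub_of_add_eq' h.symm]
      refine (norm_sub_le _ _).trans ?_
      rw [norm_mul, Complex.norm_natCast]
      have h1 : ‖∑ k ∈ Finset.range l, coeff (k + 1) f * coeff (l + 1 - (k + 1)) s‖ ≤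
          ∑ k ∈ Finset.range l, κ * ((1 + κ) ^ (k + 1) - 1) := by
        rw [← Finset.sum_range_reflect]
        refine (norm_sum_le _ _).trans (Finset.sum_le_sum fun i hi => ?_)
        have hi' := Finset.mem_range.1 hi
        rw [norm_mul]
        rw [show l + 1 - (l - 1 - i + 1) = i + 1 by omega]
        exact mul_le_mul (hκ _ (by omega)) (ih _ (by omega)) (norm_nonneg _) hκ0
      -- The geometric sum leaves exactly -(l+1)κ, which is compensated by the term (l+1) f_(l+1) of
      -- the recursion; this is why (1+κ)^l - 1 reproduces itself.
      have h2 : ∀ l : ℕ, ∑ k ∈ Finset.range l, κ * ((1 + κ) ^ (k + 1) - 1) =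
          (1 + κ) ^ (l + 1) - 1 - (l + 1) * κ := by
        intro l
        induction l with
        | zero => simp
        | succ l ihl => rw [Finset.sum_range_succ, ihl]; push_cast; ring
      rw [h2] at h1
      have h3 := mul_le_mul_of_nonneg_left (hκ (l + 1) (by omega)) (Nat.cast_nonneg (α := ℝ) (l + 1))
      rw [Nat.cast_succ] at h3 ⊢
      linarith

/-- The error propagation of the Newton-Girard extrapolation, with unspecified constants. -/
theorem norm_newtonPower_sub_le (l : List ℝ) (hl : ∀ x ∈ l, 0 ≤ x) (hsum : l.sum = 1)
    (Q : ℕ → ℂ) (t : ℕ) {η κ : ℝ} (hη : η ≤ 1)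
    (hQ : ∀ j, 1 ≤ j → j ≤ t → ‖Q j - ((l.map fun x => x ^ j).sum : ℝ)‖ ≤ η)
    (hκ : η ≤ κ) (hκ' : 1 / (t + 1).factorial +
      ∑ r ∈ Finset.range t, η * (1 + r * η) / (r + 1) / (t - r).factorial ≤ κ)
    (ht : 1 ≤ t) (i : ℕ) :
    ‖newtonPower Q t (i + 1) - ((l.map fun x => x ^ (i + 1)).sum : ℝ)‖ ≤ (1 + κ) ^ (i + 1) - 1 := by
  have hη0 : 0 ≤ η := (norm_nonneg _).trans (hQ 1 le_rfl ht)
  set L : List ℂ := l.map Complex.ofRealHom with hL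
  set P := elemSeries L
  set H := complSeries L
  set p := powerSumSeries L with hp
  have hPH : P * H = 1 := elemSeries_mul_complSeries L
  have hP : X * d⁄dX ℂ P = -(P * p) := X_mul_derivative_elemSeries L
  -- Differentiating P H = 1 turns the equation for P into the one for its inverse.
  have hH : X * d⁄dX ℂ H = H * p := by
    have h1 : d⁄dX ℂ (P * H) = 0 := by rw [hPH]; simp
    rw [Derivation.leibniz, smul_eq_mul, smul_eq_mul] at h1
    linear_combination (H * X) * h1 - H ^ 2 * hP + (H * p - X * d⁄dX ℂ H) * hPH
  have hp0 : coeff 0 p = 0 := by simp [hp, powerSumSeries]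
  have hpn : ∀ n, n ≠ 0 → coeff n p = ((l.map fun x => x ^ n).sum : ℝ) := by
    intro n hn
    rw [hp, powerSumSeries, coeff_mk, if_neg hn, hL, List.map_map]
    change _ = Complex.ofRealHom _
    rw [map_list_sum, List.map_map]
    congr 1
    refine List.map_congr_left fun x _ => ?_
    simp
  set U := newtonSeries Q with hU
  set c := U * H with hcdef
  have hPc : P * c = U := by rw [hcdef, mul_left_comm, hPH, mul_one]
  have hc : X * d⁄dX ℂ c = c * (p - positiveSeries Q) := by
    rw [hcdef, Derivation.leibniz, smul_eq_mul, smul_eq_mul]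
    linear_combination H * X_mul_derivative_newtonSeries Q + U * hH
  have hU0 : coeff 0 U = 1 := by simp [hU, newtonSeries, newtonElem]
  have hH0 : coeff 0 H = 1 := constantCoeff_complSeries L
  have hc0 : coeff 0 c = 1 := by
    rw [hcdef, coeff_mul]; simp only [Finset.Nat.antidiagonal_zero, Finset.sum_singleton]
    rw [hU0, hH0, one_mul]
  -- The series p - Q is controlled only up to degree t, which suffices because the truncation
  -- involves only c_0, …, c_t.
  have hcb := norm_coeff_le_of_derivative hc hc0
    (by rw [map_sub, hp0, coeff_positiveSeries_zero, sub_zero]) hη (t := t) (by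
      intro i h1 h2
      rw [map_sub, coeff_positiveSeries (by omega), hpn i (by omega), norm_sub_rev]
      exact hQ i h1 h2)
  set F := ((trunc (t + 1) U : Polynomial ℂ) : ℂ⟦X⟧)
  have hF : X * d⁄dX ℂ F = -(F * positiveSeries (newtonPower Q t)) :=
    X_mul_derivative_trunc_newtonSeries Q t
  have hK : X * d⁄dX ℂ (F * H) = F * H * (p - positiveSeries (newtonPower Q t)) := by
    rw [Derivation.leibniz, smul_eq_mul, smul_eq_mul]
    linear_combination H * hF + F * hH
  have hK0 : coeff 0 (F * H) = 1 := by
    rw [coeff_mul]; simp only [Finset.Nat.antidiagonal_zero, Finset.sum_singleton]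
    rw [hH0, coeff_coe_trunc_of_lt (by omega), hU0, one_mul]
  have hhook : ∀ {N q : ℕ}, q < N → ‖hookCoeff L N (q + 1)‖ ≤ 1 / (q + 1).factorial := by
    intro N q h
    rw [hL, ← map_hookCoeff]
    simpa using abs_hookCoeff_le l hl hsum h
  have hKn : ∀ n, 1 ≤ n → ‖coeff n (F * H)‖ ≤ κ := by
    intro n hn
    have h1 := coeff_trunc_mul_mul (P := P) (c := c) (H := H) t n
    rw [hPc] at h1
    change coeff n (F * H) = ∑ r ∈ _, coeff r c * if r ≤ n then hookCoeff L (n - r) (t + 1 - r)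
      else 0 at h1
    -- For n ≤ t only r = n survives and the coefficient is c_n itself. For n > t every r ≤ t
    -- contributes, with r = 0 giving 1/(t+1)! and the other r giving the sum in the hypothesis on
    -- κ.
    by_cases hnt : n ≤ t
    · rw [Finset.sum_eq_single n] at h1
      · rw [if_pos le_rfl, Nat.sub_self, show t + 1 - n = t - n + 1 by omega,
          hookCoeff_zero_left, mul_one] at h1
        rw [h1]
        obtain ⟨n, rfl⟩ : ∃ n', n = n' + 1 := ⟨n - 1, by omega⟩
        exact (hcb n hnt).1.trans hκ
      · intro r _ hr
        split_ifs with h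
        · rw [hookCoeff_eq_zero L (by omega) (by omega), mul_zero]
        · rw [mul_zero]
      · intro h; simp at h; omega
    · rw [h1]
      refine (norm_sum_le _ _).trans (le_trans ?_ hκ')
      rw [Finset.sum_range_succ', add_comm, hc0, if_pos (Nat.zero_le _), one_mul]
      refine add_le_add (hhook (by omega)) (Finset.sum_le_sum fun r hr => ?_)
      have hr' := Finset.mem_range.1 hr
      rw [if_pos (by omega), norm_mul, div_eq_mul_one_div _ ((t - r).factorial : ℝ)]
      refine mul_le_mul ?_ ?_ (norm_nonneg _) (by positivity)
      · rw [le_div_iff₀ (by positivity), mul_comm]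
        exact (hcb r (by omega)).2
      · obtain ⟨a, rfl⟩ : ∃ a, t = r + 1 + a := ⟨t - (r + 1), by omega⟩
        rw [show r + 1 + a + 1 - (r + 1) = a + 1 by omega,
          show r + 1 + a - r = a + 1 by omega]
        exact hhook (by omega)
  have := norm_coeff_le_of_logDerivative hK hK0
    (by rw [map_sub, hp0, coeff_positiveSeries_zero, sub_zero]) hKn (i + 1)
  rwa [map_sub, coeff_positiveSeries (by omega), hpn _ (by omega), norm_sub_rev] at this

end Newton

/-! ## The accuracy of the extrapolated power sums -/

section Accuracy

theorem pos_of_cutoff {k : ℕ} {ε : ℝ} (ht : 4 ≤ cutoff k ε) : 0 < k := by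
  rcases Nat.eq_zero_or_pos k with rfl | h
  · simp [cutoff] at ht
  · exact h

theorem cutoff_le_log {k : ℕ} {ε : ℝ} (ht : 4 ≤ cutoff k ε) :
    (cutoff k ε : ℝ) ≤ Real.log (2 * k / ε) :=
  (Nat.le_floor_iff' (by omega)).1 le_rfl

theorem exp_cutoff_le {k : ℕ} {ε : ℝ} (hε : 0 < ε) (ht : 4 ≤ cutoff k ε) :
    Real.exp (cutoff k ε) ≤ 2 * k / ε := by
  have hk : (0 : ℝ) < k := Nat.cast_pos.2 (pos_of_cutoff ht)
  rw [← Real.le_log_iff_exp_le (by positivity)]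
  exact cutoff_le_log ht

/-- The upper side of the floor defining t. It is what bounds k/(t+1)! by a multiple of ε. -/
theorem le_exp_cutoff {k : ℕ} {ε : ℝ} (hε : 0 < ε) (ht : 4 ≤ cutoff k ε) :
    (k : ℝ) ≤ ε * (Real.exp (cutoff k ε + 1) / 2) := by
  have hk : (0 : ℝ) < k := Nat.cast_pos.2 (pos_of_cutoff ht)
  have h : 2 * k / ε < Real.exp (cutoff k ε + 1) := by
    rw [← Real.log_lt_iff_lt_exp (by positivity)]
    exact Nat.lt_floor_add_one _
  rw [div_lt_iff₀ hε] at h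
  linarith

theorem one_lt_log_cutoff {k : ℕ} {ε : ℝ} (ht : 4 ≤ cutoff k ε) :
    1.386 < Real.log (cutoff k ε) := by
  have h4 : Real.log 4 = 2 * Real.log 2 := by
    rw [show (4 : ℝ) = 2 ^ 2 by norm_num, Real.log_pow]; norm_num
  have := Real.log_two_gt_d9
  have h : Real.log 4 ≤ Real.log (cutoff k ε) :=
    Real.log_le_log (by norm_num) (by exact_mod_cast ht)
  linarith

theorem accuracy_pos {k : ℕ} {ε : ℝ} (hε : 0 < ε) (ht : 4 ≤ cutoff k ε) : 0 < accuracy k ε := by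
  have hk : (0 : ℝ) < k := Nat.cast_pos.2 (pos_of_cutoff ht)
  have ht' : (0 : ℝ) < cutoff k ε := Nat.cast_pos.2 (by omega)
  have := one_lt_log_cutoff ht
  have hlog : 0 < Real.log (cutoff k ε) := by linarith
  unfold accuracy
  positivity

theorem mul_accuracy {k : ℕ} {ε : ℝ} (hε : 0 < ε) (ht : 4 ≤ cutoff k ε) :
    k * accuracy k ε = ε * (1 / (2 * (cutoff k ε * Real.log (cutoff k ε)))) := by
  have hk : (k : ℝ) ≠ 0 := Nat.cast_ne_zero.2 (pos_of_cutoff ht).ne'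
  unfold accuracy
  field_simp

theorem exp_one_pow_bounds : Real.exp 1 ^ 4 ≥ 54 ∧ Real.exp 1 ^ 5 ≤ 148.5 ∧ Real.exp 1 ^ 6 ≤ 404 := by
  have h1 := Real.exp_one_gt_d9
  have h2 := Real.exp_one_lt_d9
  refine ⟨le_trans (by norm_num) (pow_le_pow_left₀ (by norm_num) h1.le 4), ?_, ?_⟩
  · exact (pow_le_pow_left₀ (Real.exp_pos _).le h2.le 5).trans (by norm_num)
  · exact (pow_le_pow_left₀ (Real.exp_pos _).le h2.le 6).trans (by norm_num)

theorem accuracy_le {k : ℕ} {ε : ℝ} (hε : 0 < ε) (ht : 4 ≤ cutoff k ε) :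
    accuracy k ε ≤ 1 / 290 := by
  have hk : (0 : ℝ) < k := Nat.cast_pos.2 (pos_of_cutoff ht)
  have h1 := exp_cutoff_le hε ht
  have ht' : (4 : ℝ) ≤ cutoff k ε := by exact_mod_cast ht
  have h2 : 54 ≤ Real.exp (cutoff k ε) := by
    refine exp_one_pow_bounds.1.le.trans ?_
    rw [← Real.exp_nat_mul, mul_one]
    exact Real.exp_le_exp.2 (by exact_mod_cast ht)
  have hlog := one_lt_log_cutoff ht
  -- Here 4 · 1.386 > 5.5, and 54 · 5.5 = 297 exceeds the 290 that is claimed.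
  have h3 : 5.5 ≤ cutoff k ε * Real.log (cutoff k ε) := by nlinarith
  have h4 : 54 * ε ≤ 2 * k := by rw [← le_div_iff₀ hε]; exact h2.trans h1
  have h5 : (2 * k : ℝ) * 5.5 ≤ 2 * k * (cutoff k ε * Real.log (cutoff k ε)) := by gcongr
  unfold accuracy
  rw [div_le_div_iff₀ (by nlinarith) (by norm_num)]
  nlinarith

theorem sum_inv_factorial_le (t : ℕ) :
    ∑ r ∈ Finset.range t, (1 : ℝ) / (t - r).factorial ≤ 2 := by
  rw [← Finset.sum_range_reflect]
  calc ∑ j ∈ Finset.range t, (1 : ℝ) / (t - (t - 1 - j)).factorial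
      ≤ ∑ j ∈ Finset.range t, (1 / 2 : ℝ) ^ j := by
        refine Finset.sum_le_sum fun j hj => ?_
        have hj' := Finset.mem_range.1 hj
        rw [show t - (t - 1 - j) = j + 1 by omega, one_div_pow]
        gcongr
        have := Nat.factorial_mul_pow_le_factorial (m := 1) (n := j)
        rw [Nat.factorial_one, one_mul, add_comm 1 j] at this
        exact_mod_cast this
    _ ≤ 2 := sum_geometric_two_le t

/-- The ratio of consecutive terms is e/(t+2) < 1, so t = 5 is the worst case. -/
theorem exp_div_factorial_le {t : ℕ} (ht : 5 ≤ t) :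
    Real.exp (t + 1) / (t + 1).factorial ≤ 404 / 720 := by
  induction t, ht using Nat.le_induction with
  | base =>
    have : Real.exp ((5 : ℕ) + 1) = Real.exp 1 ^ 6 := by
      rw [← Real.exp_nat_mul]; norm_num
    rw [this]
    have h := exp_one_pow_bounds.2.2
    norm_num [Nat.factorial] at h ⊢
    linarith
  | succ t ht ih =>
    refine le_trans ?_ ih
    rw [Nat.factorial_succ (t + 1)]
    push_cast
    rw [Real.exp_add (t + 1 : ℝ), mul_comm (Real.exp _), mul_div_mul_comm]
    refine mul_le_of_le_one_left (by positivity) ?_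
    rw [div_le_one (by positivity)]
    have := Real.exp_one_lt_d9
    have : (5 : ℝ) ≤ t := by exact_mod_cast ht
    linarith

/-- Since 0.69 < ln 2, the chord of exp over [0, 0.69] has a rise less than 1; convexity puts the
graph below it. The constant 0.69 leaves just enough room for the case t = 4. -/
theorem exp_sub_one_lt {ε : ℝ} (hε : 0 < ε) (h1 : ε ≤ 1) : Real.exp (0.69 * ε) - 1 < ε := by
  have h2 : Real.exp 0.69 < 2 := by
    rw [← Real.lt_log_iff_exp_lt (by norm_num)]
    have := Real.log_two_gt_d9
    linarith
  have h := convexOn_exp.2 (Set.mem_univ 0) (Set.mem_univ 0.69)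
    (show 0 ≤ 1 - ε by linarith) hε.le (by ring)
  simp only [smul_eq_mul, mul_zero, zero_add, Real.exp_zero, mul_one] at h
  rw [mul_comm]
  nlinarith

/-- The constant of `norm_newtonPower_sub_le` for the accuracy `accuracy k ε`. -/
theorem exists_error_constant {k : ℕ} {ε : ℝ} (hε : 0 < ε) (ht : 4 ≤ cutoff k ε) :
    ∃ κ, accuracy k ε ≤ κ ∧ 1 / (cutoff k ε + 1).factorial +
      ∑ r ∈ Finset.range (cutoff k ε), accuracy k ε * (1 + r * accuracy k ε) / (r + 1) /
        (cutoff k ε - r).factorial ≤ κ ∧ k * κ ≤ 0.69 * ε := by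
  have hη := accuracy_pos hε ht
  have hη1 := accuracy_le hε ht
  have hkη := mul_accuracy hε ht
  have hke := le_exp_cutoff hε ht
  have hlog := one_lt_log_cutoff ht
  have hk : (0 : ℝ) < k := Nat.cast_pos.2 (pos_of_cutoff ht)
  set η := accuracy k ε
  set t := cutoff k ε
  rcases ht.eq_or_lt with h4 | h5
  · rw [← h4] at hkη hke hlog ⊢
    -- For t = 4 the budget is tight: k/120 already takes about 0.619 ε. The sum is evaluated
    -- exactly; its linear part is (13/24) η, and 0.56 also absorbs the η² terms because η ≤ 1/290.
    refine ⟨1 / 120 + 0.56 * η, by linarith, ?_, ?_⟩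
    · norm_num [Finset.sum_range_succ, Nat.factorial]
      nlinarith
    · have h1 : k * η ≤ ε * 0.0902 := by
        rw [hkη]
        gcongr
        rw [div_le_iff₀ (by positivity)]
        push_cast at hlog ⊢
        linarith
      have h2 : (k : ℝ) ≤ ε * 74.25 := by
        refine hke.trans ?_
        gcongr
        have h := exp_one_pow_bounds.2.1
        rw [← Real.exp_nat_mul] at h
        norm_num at h ⊢
        linarith
      linarith
  -- For t ≥ 5 the crude bounds (1 + rη)/(r + 1) ≤ 1 and ∑ 1/(t-r)! ≤ 2 suffice: kκ is at most about
  -- 0.281 ε + 0.145 ε.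
  · refine ⟨1 / (t + 1).factorial + 2 * η, ?_, ?_, ?_⟩
    · have : (0 : ℝ) < 1 / (t + 1).factorial := by positivity
      linarith
    · gcongr
      calc ∑ r ∈ Finset.range t, η * (1 + r * η) / (r + 1) / (t - r).factorial
          ≤ ∑ r ∈ Finset.range t, η * (1 / (t - r).factorial) := by
            refine Finset.sum_le_sum fun r _ => ?_
            rw [mul_one_div]
            gcongr
            rw [div_le_iff₀ (by positivity)]
            have : (r : ℝ) * η ≤ r := mul_le_of_le_one_right (Nat.cast_nonneg r) (by linarith)
            nlinarith
        _ ≤ 2 * η := by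
            rw [← Finset.mul_sum, mul_comm]
            exact mul_le_mul_of_nonneg_right (sum_inv_factorial_le t) hη.le
    · have h5' : (5 : ℝ) ≤ t := by exact_mod_cast h5
      have h1 : k * η ≤ ε * (1 / (2 * (5 * 1.386))) := by
        rw [hkη]
        gcongr
      have h2 : k * (1 / (t + 1).factorial : ℝ) ≤ ε * (202 / 720) := by
        calc k * (1 / (t + 1).factorial : ℝ)
            ≤ ε * (Real.exp (t + 1) / 2) * (1 / (t + 1).factorial : ℝ) := by gcongr
          _ = ε * (1 / 2 * (Real.exp (t + 1) / (t + 1).factorial)) := by ring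
          _ ≤ ε * (1 / 2 * (404 / 720)) := by
            have := exp_div_factorial_le h5
            exact mul_le_mul_of_nonneg_left (by linarith) hε.le
          _ = ε * (202 / 720) := by ring
      rw [mul_add]
      norm_num at h1
      nlinarith

theorem trace_pow_eq_sum_eigenvalues {ι : Type*} [Fintype ι] [DecidableEq ι] {M : Matrix ι ι ℂ}
    (hM : M.IsHermitian) (j : ℕ) : (M ^ j).trace = ∑ i, ((hM.eigenvalues i ^ j : ℝ) : ℂ) := by
  conv_lhs => rw [hM.spectral_theorem]
  rw [← map_pow, Unitary.conjStarAlgAut_apply, Matrix.trace_mul_cycle]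
  simp [Matrix.diagonal_pow, Matrix.trace_diagonal]

theorem norm_newtonPower_sub_trace_lt {ι : Type*} [Fintype ι] [DecidableEq ι] (k : ℕ) {ε : ℝ}
    (ρ : QState ι) (Q : ℕ → ℂ) (hε : 0 < ε) (h1 : ε ≤ 1) (ht : 4 ≤ cutoff k ε)
    (hQ : ∀ j, 1 ≤ j → j ≤ cutoff k ε → ‖Q j - (ρ.mat ^ j).trace‖ < accuracy k ε)
    (i : ℕ) (hi : 1 ≤ i) (hik : i ≤ k) :
    ‖newtonPower Q (cutoff k ε) i - (ρ.mat ^ i).trace‖ < ε := by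
  obtain ⟨κ, hκ1, hκ2, hκ3⟩ := exists_error_constant hε ht
  have hκ0 : 0 ≤ κ := (accuracy_pos hε ht).le.trans hκ1
  set e := ρ.posSemidef.isHermitian.eigenvalues
  set l : List ℝ := Finset.univ.toList.map e
  have htr : ∀ j, (ρ.mat ^ j).trace = ((l.map fun x => x ^ j).sum : ℝ) := by
    intro j
    rw [trace_pow_eq_sum_eigenvalues ρ.posSemidef.isHermitian, List.map_map, Finset.sum_map_toList]
    simp only [Function.comp_def, Complex.ofReal_sum]
    rfl
  have hl : ∀ x ∈ l, 0 ≤ x := by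
    intro x hx
    obtain ⟨a, -, rfl⟩ := List.mem_map.1 hx
    exact ρ.posSemidef.eigenvalues_nonneg a
  have hs : l.sum = 1 := by
    have := htr 1
    rw [pow_one, ρ.trace_eq_one] at this
    simpa using (Complex.ofReal_injective this).symm
  obtain ⟨i, rfl⟩ : ∃ i', i = i' + 1 := ⟨i - 1, by omega⟩
  rw [htr]
  refine (norm_newtonPower_sub_le l hl hs Q (cutoff k ε)
    ((accuracy_le hε ht).trans (by norm_num)) (fun j a b => ?_) hκ1 hκ2 (by omega) i).trans_lt ?_
  · rw [← htr]
    exact (hQ j a b).le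
  · refine lt_of_le_of_lt ?_ (exp_sub_one_lt hε h1)
    gcongr
    calc (1 + κ) ^ (i + 1) ≤ (1 + κ) ^ k := by gcongr; linarith
      _ ≤ Real.exp κ ^ k := by gcongr; linarith [Real.add_one_le_exp κ]
      _ = Real.exp (k * κ) := (Real.exp_nat_mul _ _).symm
      _ ≤ _ := Real.exp_le_exp.2 hκ3

end Accuracy

/-! ## Layers of classical reversible gates -/

section ClassicalGates

variable {W : Type} [DecidableEq W]

/-- The action of a gate on computational basis states (trivial for Hadamard gates). -/
def Gate.act : Gate W → (W → Bool) → W → Bool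
  | .hadamard _ => id
  | .pauliX a => flipIf a fun _ => true
  | .cnot c a _ => flipIf a fun x => x c
  | .cswap c a b _ _ _ => swapIf c a b

theorem Gate.act_of_notMem (g : Gate W) (x : W → Bool) {w : W} (hw : w ∉ g.support) :
    g.act x w = x w := by
  cases g with
  | hadamard a => rfl
  | pauliX a =>
    simp only [Gate.support, Finset.mem_singleton] at hw
    simp [Gate.act, flipIf, hw]
  | cnot c a h =>
    simp only [Gate.support, Finset.mem_insert, Finset.mem_singleton, not_or] at hw
    simp [Gate.act, flipIf, hw]
  | cswap c a b h h' h'' =>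
    simp only [Gate.support, Finset.mem_insert, Finset.mem_singleton, not_or] at hw
    simp only [Gate.act, swapIf]
    split_ifs
    · simp [Equiv.swap_apply_of_ne_of_ne hw.2.1 hw.2.2]
    · rfl

theorem Gate.act_congr (g : Gate W) {x y : W → Bool} (h : ∀ v ∈ g.support, x v = y v) {w : W}
    (hw : w ∈ g.support) : g.act x w = g.act y w := by
  cases g with
  | hadamard a => exact h w hw
  | pauliX a =>
    simp only [Gate.support, Finset.mem_singleton, forall_eq] at hw h
    simp [Gate.act, flipIf, hw, h]
  | cnot c a hc =>
    simp only [Gate.support, Finset.mem_insert, Finset.mem_singleton, forall_eq_or_imp,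
      forall_eq] at hw h
    rcases hw with rfl | rfl
    · simp [Gate.act, flipIf, hc, h]
    · simp [Gate.act, flipIf, h]
  | cswap c a b h1 h2 h3 =>
    simp only [Gate.support, Finset.mem_insert, Finset.mem_singleton, forall_eq_or_imp,
      forall_eq] at hw h
    obtain ⟨hc, ha, hb⟩ := h
    simp only [Gate.act, swapIf, hc]
    rcases hw with rfl | rfl | rfl <;> split_ifs <;>
      simp [Equiv.swap_apply_of_ne_of_ne h1 h2, *]

theorem Gate.act_act (g : Gate W) (x : W → Bool) : g.act (g.act x) = x := by
  cases g with
  | hadamard a => rfl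
  | pauliX a => simp [Gate.act, flipIf]
  | cnot c a hc => simp [Gate.act, flipIf, hc]
  | cswap c a b h1 h2 h3 =>
    simp only [Gate.act, swapIf]
    by_cases h : x c = true
    · simp [h, Equiv.swap_apply_of_ne_of_ne h1 h2, Function.comp_assoc, ← Equiv.coe_trans]
    · simp [h]

/-- The action of a layer on computational basis states. -/
def Layer.act (L : Layer W) (x : W → Bool) : W → Bool := L.gates.foldr Gate.act x

theorem foldr_act_of_notMem {l : List (Gate W)} {x : W → Bool} {w : W}
    (hw : ∀ g ∈ l, w ∉ g.support) : l.foldr Gate.act x w = x w := by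
  induction l with
  | nil => rfl
  | cons g l ih =>
    rw [List.foldr_cons, g.act_of_notMem _ (hw g (by simp)), ih fun g hg => hw g (by simp [hg])]

/-- Gates with disjoint supports neither read nor write each other's qubits, so their order in the
list is irrelevant. -/
theorem foldr_act_of_mem {l : List (Gate W)}
    (hl : l.Pairwise fun g h => Disjoint g.support h.support) {g : Gate W} (hg : g ∈ l)
    {x : W → Bool} {w : W} (hw : w ∈ g.support) : l.foldr Gate.act x w = g.act x w := by
  induction l with
  | nil => simp at hg
  | cons k l ih =>
    rw [List.pairwise_cons] at hl
    rw [List.foldr_cons]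
    rcases List.mem_cons.1 hg with rfl | hg
    · refine g.act_congr (fun v hv => foldr_act_of_notMem fun k hk hvk => ?_) hw
      exact Finset.disjoint_left.1 (hl.1 k hk) hv hvk
    · rw [k.act_of_notMem, ih hl.2 hg]
      exact Finset.disjoint_right.1 (hl.1 g hg) hw

theorem Layer.act_of_notMem (L : Layer W) {x : W → Bool} {w : W}
    (hw : ∀ g ∈ L.gates, w ∉ g.support) : L.act x w = x w := foldr_act_of_notMem hw

theorem Layer.act_of_mem (L : Layer W) {g : Gate W} (hg : g ∈ L.gates) (x : W → Bool) {w : W}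
    (hw : w ∈ g.support) : L.act x w = g.act x w := foldr_act_of_mem L.disjoint hg hw

theorem Layer.act_act (L : Layer W) (x : W → Bool) : L.act (L.act x) = x := by
  funext w
  by_cases h : ∃ g ∈ L.gates, w ∈ g.support
  · obtain ⟨g, hg, hw⟩ := h
    rw [L.act_of_mem hg _ hw, g.act_congr (fun v hv => L.act_of_mem hg x hv) hw, g.act_act]
  · push Not at h
    rw [L.act_of_notMem h, L.act_of_notMem h]

/-- A layer without Hadamard gates. -/
def Layer.IsClassical (L : Layer W) : Prop := ∀ g ∈ L.gates, ∀ a, g ≠ Gate.hadamard a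

variable [Fintype W]

theorem basisMap_mul (f g : (W → Bool) → W → Bool) :
    basisMap f * basisMap g = basisMap (f ∘ g) := by
  ext x y
  simp [basisMap, Matrix.mul_apply]

theorem Layer.IsClassical.matrix_eq {L : Layer W} (hL : L.IsClassical) :
    L.matrix = basisMap L.act := by
  unfold Layer.matrix Layer.act Layer.IsClassical at *
  generalize L.gates = l at hL
  induction l with
  | nil =>
    ext x y
    by_cases h : x = y <;> simp [basisMap, h]
  | cons g l ih =>
    have hg : g.matrix = basisMap g.act := by
      cases g with
      | hadamard a => exact absurd rfl (hL _ (by simp) a)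
      | pauliX a => rfl
      | cnot c a h => rfl
      | cswap c a b h h' h'' => rfl
    rw [List.map_cons, List.prod_cons, ih fun g hg => hL g (by simp [hg]), hg, basisMap_mul]
    rfl

theorem basisMap_conj_apply {f : (W → Bool) → W → Bool} (hf : ∀ x, f (f x) = x)
    (σ : Matrix (W → Bool) (W → Bool) ℂ) (x y : W → Bool) :
    (basisMap f * σ * (basisMap f)ᴴ) x y = σ (f x) (f y) := by
  have h : ∀ u v, v = f u ↔ u = f v := fun u v =>
    ⟨fun e => by rw [e, hf], fun e => by rw [e, hf]⟩
  simp only [basisMap, Matrix.mul_apply, Matrix.conjTranspose_apply, Matrix.of_apply, apply_ite star,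
    star_one, star_zero, fun u => h u x, fun u => h u y, mul_ite, mul_one, mul_zero, ite_mul, one_mul, zero_mul,
    Finset.sum_ite_eq', Finset.mem_univ, if_true]

theorem postState_apply (L : Layer W) (M : Finset W) (o : M → Bool)
    (σ : Matrix (W → Bool) (W → Bool) ℂ) (x y : W → Bool) :
    postState L M o σ x y = if (∀ w : M, x w = o w) ∧ (∀ w : M, y w = o w) then
      (L.matrix * σ * L.matrixᴴ) x y else 0 := by
  have : postState L M o σ = measProj M o * (L.matrix * σ * L.matrixᴴ) * (measProj M o)ᴴ := by
    rw [postState, Matrix.conjTranspose_mul]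
    simp only [Matrix.mul_assoc]
  rw [this, measProj, Matrix.diagonal_conjTranspose, Matrix.mul_diagonal, Matrix.diagonal_mul]
  simp only [Pi.star_apply, apply_ite, star_one, star_zero]
  by_cases h1 : ∀ w : M, x w = o w
  · by_cases h2 : ∀ w : M, y w = o w
    · rw [if_pos h1, if_pos h2, if_pos ⟨h1, h2⟩, one_mul, mul_one]
    · rw [if_neg h2, if_neg fun h => h2 h.2, mul_zero]
  · rw [if_neg h1, if_neg fun h => h1 h.1]
    simp

theorem Layer.IsClassical.postState_apply {L : Layer W} (hL : L.IsClassical) (M : Finset W)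
    (o : M → Bool) (σ : Matrix (W → Bool) (W → Bool) ℂ) (x y : W → Bool) :
    postState L M o σ x y = if (∀ w : M, x w = o w) ∧ (∀ w : M, y w = o w) then
      σ (L.act x) (L.act y) else 0 := by
  rw [_root_.postState_apply, hL.matrix_eq, basisMap_conj_apply L.act_act]

end ClassicalGates

/-! ## The expectation of the output sign -/

section Expectation

variable {W : Type} [Fintype W] [DecidableEq W]

/-- The expectation of `(-1) ^ (output bit)`, before taking real parts. -/
noncomputable def Prog.expect : Prog W → Matrix (W → Bool) (W → Bool) ℂ → ℂ
  | .halt out, σ => (if out then -1 else 1) * σ.trace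
  | .round L M next, σ => ∑ o : M → Bool, (next o).expect (postState L M o σ)

theorem Prog.prob_false_sub_prob_true (p : Prog W) (σ : Matrix (W → Bool) (W → Bool) ℂ) :
    p.prob σ false - p.prob σ true = (p.expect σ).re := by
  induction p generalizing σ with
  | halt out => cases out <;> simp [Prog.prob, Prog.expect]
  | round L M next ih =>
    simp only [Prog.prob, Prog.expect, Complex.re_sum, ← Finset.sum_sub_distrib, ih]

/-- The expectation of the program is the sum of the matrix entries at `(α x, β x)`. -/
def Prog.HasForm (p : Prog W) (α β : (W → Bool) → W → Bool) : Prop :=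
  ∀ σ, p.expect σ = ∑ x, σ (α x) (β x)

/-- Backward (Heisenberg) propagation. A classical layer is an involution on basis states, so it is
composed onto both index maps. If both maps fix the measured bits, only the outcome read off from x
contributes, and the adaptive choice becomes a dependence on x. -/
theorem Prog.HasForm.round {L : Layer W} (hL : L.IsClassical) {M : Finset W}
    {next : (M → Bool) → Prog W} {α β : (M → Bool) → (W → Bool) → W → Bool}
    (h : ∀ o, (next o).HasForm (α o) (β o)) (hα : ∀ o x, ∀ w ∈ M, α o x w = x w)
    (hβ : ∀ o x, ∀ w ∈ M, β o x w = x w) :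
    (Prog.round L M next).HasForm (fun x => L.act (α (fun w => x w) x))
      (fun x => L.act (β (fun w => x w) x)) := by
  intro σ
  simp only [Prog.expect, h _ _, hL.postState_apply]
  rw [Finset.sum_comm]
  refine Finset.sum_congr rfl fun x _ => ?_
  rw [Finset.sum_eq_single fun w : M => x w]
  · rw [if_pos]
    exact ⟨fun w => hα _ _ w w.2, fun w => hβ _ _ w w.2⟩
  · intro o _ ho
    rw [if_neg]
    rintro ⟨h1, -⟩
    exact ho (funext fun w => by rw [← h1 w, hα _ _ w w.2])
  · simp

theorem Prog.HasForm.round_empty {L : Layer W} (hL : L.IsClassical) {next : Prog W}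
    {α β : (W → Bool) → W → Bool} (h : next.HasForm α β) :
    (Prog.round L ∅ fun _ => next).HasForm (fun x => L.act (α x)) (fun x => L.act (β x)) :=
  Prog.HasForm.round (α := fun _ => α) (β := fun _ => β) hL (fun _ => h) (by simp) (by simp)

end Expectation

/-! ## Layers of Hadamard gates -/

section Hadamard

variable {W : Type} [Fintype W] [DecidableEq W]

/-- The sign `(-1) ^ (p q)`. -/
def andSign (p q : Bool) : ℂ := if p && q then -1 else 1

theorem hadamard_row_sum (a : W) (x : W → Bool) (F : (W → Bool) → ℂ) :
    ∑ u, (Gate.hadamard a).matrix x u * F u =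
      (andSign (x a) false * F (Function.update x a false) +
        andSign (x a) true * F (Function.update x a true)) / ((Real.sqrt 2 : ℝ) : ℂ) := by
  rw [Fintype.sum_eq_add (Function.update x a false) (Function.update x a true)]
  · have h : ∀ b, ∀ w, w ≠ a → x w = Function.update x a b w := fun b w hw => by
      rw [Function.update_of_ne hw]
    simp only [Gate.matrix, Matrix.of_apply, if_pos (h _), Function.update_self, andSign]
    ring
  · intro e
    have := congrFun e a
    simp at this
  · rintro u ⟨h0, h1⟩
    have hu : ¬ ∀ w, w ≠ a → x w = u w := by
      intro h
      have : u = Function.update x a (u a) := by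
        funext w
        by_cases hw : w = a
        · subst hw; simp
        · rw [Function.update_of_ne hw, h w hw]
      cases hua : u a
      · exact h0 (by rw [← hua]; exact this)
      · exact h1 (by rw [← hua]; exact this)
    simp [Gate.matrix, hu]

theorem hadamard_conj_apply (a : W) (τ : Matrix (W → Bool) (W → Bool) ℂ) (x y : W → Bool) :
    ((Gate.hadamard a).matrix * τ * (Gate.hadamard a).matrixᴴ) x y =
      1 / 2 * ∑ b : Bool, ∑ c : Bool, andSign (x a) b * andSign (y a) c *
        τ (Function.update x a b) (Function.update y a c) := by
  have hs : ((Real.sqrt 2 : ℝ) : ℂ) * ((Real.sqrt 2 : ℝ) : ℂ) = 2 := by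
    rw [← Complex.ofReal_mul, Real.mul_self_sqrt (by norm_num)]; norm_num
  have hs0 : ((Real.sqrt 2 : ℝ) : ℂ) ≠ 0 := by
    intro h; rw [h] at hs; norm_num at hs
  have hstar : ∀ u, star ((Gate.hadamard a).matrix y u) = (Gate.hadamard a).matrix y u := by
    intro u
    simp only [Gate.matrix, Matrix.of_apply]
    split_ifs <;> simp
  rw [Matrix.mul_apply]
  simp only [Matrix.conjTranspose_apply, hstar]
  simp only [mul_comm _ ((Gate.hadamard a).matrix y _)]
  rw [hadamard_row_sum]
  simp only [Matrix.mul_apply, hadamard_row_sum, Fintype.sum_bool]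
  field_simp
  rw [sq, hs]
  ring

/-- The matrix of a list of Hadamard gates. -/
noncomputable def hadamards (l : List W) : Matrix (W → Bool) (W → Bool) ℂ :=
  (l.map fun a => (Gate.hadamard a).matrix).prod

theorem hadamards_cons_conj (a : W) (l : List W) (τ : Matrix (W → Bool) (W → Bool) ℂ) :
    hadamards (a :: l) * τ * (hadamards (a :: l))ᴴ =
      (Gate.hadamard a).matrix * (hadamards l * τ * (hadamards l)ᴴ) *
        (Gate.hadamard a).matrixᴴ := by
  simp only [hadamards, List.map_cons, List.prod_cons, Matrix.conjTranspose_mul, Matrix.mul_assoc]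

/-- Set the bits in `l` to `0`. -/
def zeroOn (l : List W) (x : W → Bool) : W → Bool := fun w => if w ∈ l then false else x w

/-- Flip the bits in `l`. -/
def flipOn (l : List W) (x : W → Bool) : W → Bool := fun w => if w ∈ l then !x w else x w

/-- The parity of the bits in `l`. -/
def parity (l : List W) (x : W → Bool) : Bool := l.foldr (fun a b => x a ^^ b) false

/-- Hadamard gates on qubits in the state `|0⟩` prepare uniform superpositions. -/
theorem hadamards_conj_apply {l : List W} (hl : l.Nodup) {τ : Matrix (W → Bool) (W → Bool) ℂ}
    (hτ : ∀ x y, ∀ a ∈ l, x a = true ∨ y a = true → τ x y = 0) (x y : W → Bool) :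
    (hadamards l * τ * (hadamards l)ᴴ) x y =
      (1 / 2) ^ l.length * τ (zeroOn l x) (zeroOn l y) := by
  induction l generalizing x y with
  | nil =>
    have : ∀ x : W → Bool, zeroOn [] x = x := fun x => by funext w; simp [zeroOn]
    simp [hadamards, this]
  | cons a l ih =>
    rw [List.nodup_cons] at hl
    have ih' := ih hl.2 fun x y b hb => hτ x y b (by simp [hb])
    have h0 : ∀ x b, zeroOn l (Function.update x a b) a = b := by
      intro x b
      simp [zeroOn, hl.1]
    have h1 : ∀ x, zeroOn l (Function.update x a false) = zeroOn (a :: l) x := by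
      intro x
      funext w
      by_cases hw : w = a
      · subst hw; simp [zeroOn]
      · simp [zeroOn, hw]
    rw [hadamards_cons_conj, hadamard_conj_apply]
    simp only [ih', Fintype.sum_bool]
    -- Of the four terms for the bit a of x and of y, three have a bit equal to 1 and vanish; the
    -- remaining one carries the factor 1/2.
    rw [hτ (zeroOn l (Function.update x a true)) _ a (by simp) (Or.inl (h0 _ _)),
      hτ (zeroOn l (Function.update x a true)) _ a (by simp) (Or.inl (h0 _ _)),
      hτ _ (zeroOn l (Function.update y a true)) a (by simp) (Or.inr (h0 _ _)), h1, h1,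
      List.length_cons, pow_succ]
    simp [andSign]
    ring

theorem sum_update_add_update (a : W) (F : (W → Bool) → ℂ) :
    ∑ x, (F (Function.update x a false) + F (Function.update x a true)) = 2 * ∑ x, F x := by
  have h : ∀ x, F (Function.update x a false) + F (Function.update x a true) =
      F x + F (flipOn [a] x) := by
    intro x
    have h1 : Function.update x a (x a) = x := Function.update_eq_self a x
    have h2 : flipOn [a] x = Function.update x a (!x a) := by
      funext w
      by_cases hw : w = a
      · subst hw; simp [flipOn]
      · simp [flipOn, hw]
    rw [h2]
    cases hx : x a <;> rw [hx] at h1 <;> simp [h1, add_comm]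
  have hinv : Function.Involutive (flipOn [a] : (W → Bool) → W → Bool) := by
    intro x
    funext w
    by_cases hw : w = a <;> simp [flipOn, hw]
  simp only [h]
  rw [Finset.sum_add_distrib, show ∑ x, F (flipOn [a] x) = ∑ x, F x from
    Equiv.sum_comp hinv.toPerm F, two_mul]

/-- The relation H Z H = X on the qubit a. The function v carries the signs of the other qubits and
f the flips already collected, so that the lemma can be applied one qubit at a time. -/
theorem sum_sign_mul_hadamard_conj {a : W} {v : (W → Bool) → ℂ} {f : (W → Bool) → W → Bool}
    (hv : ∀ x b, v (Function.update x a b) = v x)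
    (hf : ∀ x b, f (Function.update x a b) = Function.update (f x) a b)
    (τ : Matrix (W → Bool) (W → Bool) ℂ) :
    ∑ x, (if x a then -1 else 1) * v x *
        ((Gate.hadamard a).matrix * τ * (Gate.hadamard a).matrixᴴ) x (f x) =
      ∑ x, v x * τ x (flipOn [a] (f x)) := by
  have h2 : ∀ y b, flipOn [a] (Function.update y a b) = Function.update y a (!b) := by
    intro y b
    funext w
    by_cases hw : w = a
    · subst hw; simp [flipOn]
    · simp [flipOn, hw]
  apply mul_left_cancel₀ (two_ne_zero (α := ℂ))
  rw [← sum_update_add_update a, ← sum_update_add_update a]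
  refine Finset.sum_congr rfl fun x _ => ?_
  simp only [hadamard_conj_apply, hv, hf, h2, Fintype.sum_bool, Function.update_self,
    Function.update_idem, andSign]
  simp
  ring

/-- Measuring qubits in the Hadamard basis amounts to an expectation of Pauli `X` operators. -/
theorem sum_parity_mul_hadamards_conj {l : List W} (hl : l.Nodup)
    {f : (W → Bool) → W → Bool}
    (hf : ∀ a ∈ l, ∀ x b, f (Function.update x a b) = Function.update (f x) a b)
    (τ : Matrix (W → Bool) (W → Bool) ℂ) :
    ∑ x, (if parity l x then -1 else 1) * (hadamards l * τ * (hadamards l)ᴴ) x (f x) =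
      ∑ x, τ x (flipOn l (f x)) := by
  induction l generalizing f with
  | nil =>
    have : ∀ x : W → Bool, flipOn [] x = x := fun x => by funext w; simp [flipOn]
    simp [hadamards, parity, this]
  | cons a l ih =>
    rw [List.nodup_cons] at hl
    have h1 : ∀ x : W → Bool, (if parity (a :: l) x then (-1 : ℂ) else 1) =
        (if x a then -1 else 1) * (if parity l x then -1 else 1) := by
      intro x
      have hxor : ∀ p q : Bool, (if p ^^ q then (-1 : ℂ) else 1) =
          (if p then -1 else 1) * (if q then -1 else 1) := by
        intro p q
        cases p <;> cases q <;> simp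
      exact hxor (x a) (parity l x)
    have h2 : ∀ (x : W → Bool) b, parity l (Function.update x a b) = parity l x := by
      intro x b
      have : ∀ l : List W, a ∉ l → parity l (Function.update x a b) = parity l x := by
        intro l
        induction l with
        | nil => simp [parity]
        | cons c l ih =>
          intro h
          rw [List.mem_cons, not_or] at h
          have := ih h.2
          simp only [parity, List.foldr_cons] at this ⊢
          rw [this, Function.update_of_ne (Ne.symm h.1)]
      exact this l hl.1
    simp only [h1, hadamards_cons_conj]
    rw [sum_sign_mul_hadamard_conj (v := fun x => if parity l x then -1 else 1)
      (fun x b => by simp only [h2]) (hf a (by simp)), ih hl.2]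
    · refine Finset.sum_congr rfl fun x _ => ?_
      congr 1
      funext w
      by_cases hw : w = a
      · subst hw; simp [flipOn, hl.1]
      · simp [flipOn, hw]
    · intro c hc x b
      rw [hf c (by simp [hc])]
      have hca : c ≠ a := fun e => hl.1 (e ▸ hc)
      funext w
      by_cases hw : w = c
      · subst hw; simp [flipOn, hca]
      · simp [flipOn, Function.update_of_ne hw]

/-- A layer of Hadamard gates. -/
def hadamardLayer (l : List W) (hl : l.Nodup) : Layer W where
  gates := l.map Gate.hadamard
  disjoint := by
    rw [List.pairwise_map]
    exact hl.imp fun h => by simpa [Gate.support] using h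

theorem hadamardLayer_matrix (l : List W) (hl : l.Nodup) :
    (hadamardLayer l hl).matrix = hadamards l := by
  simp [hadamardLayer, Layer.matrix, hadamards, Function.comp_def]

/-- Extend a measurement outcome by zeros. -/
def extendOutcome (M : Finset W) (o : M → Bool) (w : W) : Bool :=
  if h : w ∈ M then o ⟨w, h⟩ else false

/-- The program that measures the qubits in `l` in the Hadamard basis and outputs the parity. -/
def parityProg (l : List W) (hl : l.Nodup) : Prog W :=
  .round (hadamardLayer l hl) l.toFinset fun o => .halt (parity l (extendOutcome _ o))

/-- The sign of the parity is Z on every qubit of l; conjugation by the Hadamard gates makes it X on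
every qubit, whose expectation is a sum of entries at x and its flip. This starts the backward
propagation. -/
theorem parityProg_hasForm (l : List W) (hl : l.Nodup) :
    (parityProg l hl).HasForm id (flipOn l) := by
  intro σ
  have h := sum_parity_mul_hadamards_conj (f := id) hl (fun _ _ _ _ => rfl) σ
  simp only [id_eq] at h
  change _ = ∑ x, σ x (flipOn l x)
  rw [← h]
  simp only [parityProg, Prog.expect, Matrix.trace, Matrix.diag, Finset.mul_sum]
  rw [Finset.sum_comm]
  refine Finset.sum_congr rfl fun x _ => ?_
  rw [Finset.sum_eq_single fun w : l.toFinset => x w]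
  · have hpost : postState (hadamardLayer l hl) l.toFinset (fun w => x w) σ x x =
        (hadamards l * σ * (hadamards l)ᴴ) x x := by
      rw [postState_apply, if_pos (by simp), hadamardLayer_matrix]
    have : ∀ l' : List W, (∀ a ∈ l', a ∈ l) →
        parity l' (extendOutcome l.toFinset fun w => x w) = parity l' x := by
      intro l'
      induction l' with
      | nil => simp [parity]
      | cons c l' ih =>
        intro h
        have := ih fun a ha => h a (by simp [ha])
        simp only [parity, List.foldr_cons] at this ⊢
        rw [this, extendOutcome, dif_pos (by simpa using h c (by simp))]
    rw [this l fun _ h => h, hpost]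
  · intro o _ ho
    have hpost : postState (hadamardLayer l hl) l.toFinset o σ x x = 0 := by
      rw [postState_apply, if_neg]
      rintro ⟨h1, -⟩
      exact ho (funext fun w => (h1 w).symm)
    rw [hpost, mul_zero]
  · simp

end Hadamard

/-! ## A constant-depth circuit for controlled permutations -/

section ShiftTest

variable {D : Type} {m : ℕ}

/-- The control qubits. -/
def ctl (D : Type) (i : Fin m) : D ⊕ Fin (m + m) := Sum.inr (Fin.castAdd m i)

/-- The qubits used to measure parities of neighbouring control qubits. -/
def par (D : Type) (i : Fin m) : D ⊕ Fin (m + m) := Sum.inr (Fin.natAdd m i)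

/-- The configuration with data bits `z`, control bits `u` and parity bits `o`. -/
def config (z : D → Bool) (u o : Fin m → Bool) : D ⊕ Fin (m + m) → Bool :=
  Sum.elim z (Fin.append u o)

@[simp] theorem config_inl (z : D → Bool) (u o : Fin m → Bool) (d : D) :
    config z u o (Sum.inl d) = z d := rfl

@[simp] theorem config_ctl (z : D → Bool) (u o : Fin m → Bool) (i : Fin m) :
    config z u o (ctl D i) = u i := by simp [config, ctl]

@[simp] theorem config_par (z : D → Bool) (u o : Fin m → Bool) (i : Fin m) :
    config z u o (par D i) = o i :=
  Fin.append_right u o i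

@[simp] theorem ctl_inj {i k : Fin m} : ctl D i = ctl D k ↔ i = k := by simp [ctl]

@[simp] theorem par_inj {i k : Fin m} : par D i = par D k ↔ i = k := by simp [par]

@[simp] theorem ctl_ne_par (i k : Fin m) : ctl D i ≠ par D k := by
  intro h
  have := congrArg Fin.val (Sum.inr_injective h)
  simp at this
  omega

@[simp] theorem par_ne_ctl (i k : Fin m) : par D i ≠ ctl D k := (ctl_ne_par k i).symm

@[simp] theorem ctl_ne_inl (i : Fin m) (d : D) : ctl D i ≠ Sum.inl d := Sum.inr_ne_inl

@[simp] theorem par_ne_inl (i : Fin m) (d : D) : par D i ≠ Sum.inl d := Sum.inr_ne_inl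

@[simp] theorem inl_ne_ctl (i : Fin m) (d : D) : Sum.inl d ≠ ctl D i := Sum.inl_ne_inr

@[simp] theorem inl_ne_par (i : Fin m) (d : D) : Sum.inl d ≠ par D i := Sum.inl_ne_inr

theorem wire_ext {x y : D ⊕ Fin (m + m) → Bool} (h1 : ∀ d, x (Sum.inl d) = y (Sum.inl d))
    (h2 : ∀ i, x (ctl D i) = y (ctl D i)) (h3 : ∀ i, x (par D i) = y (par D i)) : x = y := by
  funext w
  rcases w with d | i
  · exact h1 d
  · exact Fin.addCases (motive := fun i => x (Sum.inr i) = y (Sum.inr i)) h2 h3 i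

/-- Splitting a configuration into its parts. -/
def configEquiv : (D → Bool) × ((Fin m → Bool) × (Fin m → Bool)) ≃ (D ⊕ Fin (m + m) → Bool) :=
  ((Equiv.refl _).prodCongr (Fin.appendEquiv m m)).trans
    (Equiv.sumArrowEquivProdArrow D (Fin (m + m)) Bool).symm

theorem configEquiv_apply (p : (D → Bool) × ((Fin m → Bool) × (Fin m → Bool))) :
    configEquiv p = config p.1 p.2.1 p.2.2 := by
  funext w
  rcases w with d | i <;> rfl

/-- The list of the control qubits. -/
def ctlList (D : Type) (m : ℕ) : List (D ⊕ Fin (m + m)) := (List.finRange m).map (ctl D)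

theorem ctlList_nodup : (ctlList D m).Nodup :=
  (List.nodup_finRange m).map fun _ _ => ctl_inj.1

theorem mem_ctlList (i : Fin m) : ctl D i ∈ ctlList D m :=
  List.mem_map_of_mem (List.mem_finRange i)

theorem par_notMem_ctlList (i : Fin m) : par D i ∉ ctlList D m := by
  simp [ctlList]

theorem inl_notMem_ctlList (d : D) : Sum.inl d ∉ ctlList D m := by
  simp [ctlList]

variable [DecidableEq D]

theorem flipOn_config (z : D → Bool) (u o : Fin m → Bool) :
    flipOn (ctlList D m) (config z u o) = config z (fun i => !u i) o := by
  apply wire_ext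
  · simp [flipOn, inl_notMem_ctlList]
  · simp [flipOn, mem_ctlList]
  · simp [flipOn, par_notMem_ctlList]

theorem zeroOn_config (z : D → Bool) (u o : Fin m → Bool) :
    zeroOn (ctlList D m) (config z u o) = config z (fun _ => false) o := by
  apply wire_ext
  · simp [zeroOn, inl_notMem_ctlList]
  · simp [zeroOn, mem_ctlList]
  · simp [zeroOn, par_notMem_ctlList]

/-- CNOT gates from the control qubits, permuted by `π`, to the parity qubits. -/
def cnotLayer (D : Type) [DecidableEq D] (π : Equiv.Perm (Fin m)) : Layer (D ⊕ Fin (m + m)) where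
  gates := (List.finRange m).map fun i => .cnot (ctl D (π i)) (par D i) (ctl_ne_par _ _)
  disjoint := by
    rw [List.pairwise_map]
    refine (List.nodup_finRange m).imp fun h => ?_
    simp [Gate.support, h.symm]

theorem cnotLayer_isClassical (π : Equiv.Perm (Fin m)) : (cnotLayer D π).IsClassical := by
  intro g hg a
  obtain ⟨i, -, rfl⟩ := List.mem_map.1 hg
  nofun

theorem cnotLayer_act (π : Equiv.Perm (Fin m)) (z : D → Bool) (u o : Fin m → Bool) :
    (cnotLayer D π).act (config z u o) = config z u fun i => o i ^^ u (π i) := by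
  have hmem : ∀ i : Fin m, Gate.cnot (ctl D (π i)) (par D i) (ctl_ne_par _ _) ∈
      (cnotLayer D π).gates := fun i => List.mem_map_of_mem (List.mem_finRange i)
  apply wire_ext
  · intro d
    rw [Layer.act_of_notMem]
    · rfl
    · intro g hg
      obtain ⟨i, -, rfl⟩ := List.mem_map.1 hg
      simp [Gate.support]
  · intro i
    obtain ⟨k, rfl⟩ := π.surjective i
    rw [Layer.act_of_mem _ (hmem k) _ (by simp [Gate.support])]
    simp [Gate.act, flipIf]
  · intro i
    rw [Layer.act_of_mem _ (hmem i) _ (by simp [Gate.support])]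
    simp [Gate.act, flipIf]

/-- Pauli `X` gates on the control qubits selected by `s`. -/
def pauliLayer (D : Type) [DecidableEq D] (s : Fin m → Bool) : Layer (D ⊕ Fin (m + m)) where
  gates := ((List.finRange m).filter s).map fun i => .pauliX (ctl D i)
  disjoint := by
    rw [List.pairwise_map]
    refine ((List.nodup_finRange m).filter _).imp fun h => ?_
    simpa [Gate.support] using h

theorem pauliLayer_isClassical (s : Fin m → Bool) : (pauliLayer D s).IsClassical := by
  intro g hg a
  obtain ⟨i, -, rfl⟩ := List.mem_map.1 hg
  nofun

theorem pauliLayer_act (s : Fin m → Bool) (z : D → Bool) (u o : Fin m → Bool) :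
    (pauliLayer D s).act (config z u o) = config z (fun i => u i ^^ s i) o := by
  apply wire_ext
  · intro d
    rw [Layer.act_of_notMem]
    · rfl
    · intro g hg
      obtain ⟨i, -, rfl⟩ := List.mem_map.1 hg
      simp [Gate.support]
  · intro i
    by_cases hs : s i = true
    · have hmem : Gate.pauliX (ctl D i) ∈ (pauliLayer D s).gates :=
        List.mem_map_of_mem (List.mem_filter.2 ⟨List.mem_finRange i, hs⟩)
      rw [Layer.act_of_mem _ hmem _ (by simp [Gate.support])]
      simp [Gate.act, flipIf, hs]
    · rw [Layer.act_of_notMem]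
      · simp [hs]
      · intro g hg
        obtain ⟨k, hk, rfl⟩ := List.mem_map.1 hg
        have hk' := (List.mem_filter.1 hk).2
        simp only [Gate.support, Finset.mem_singleton, ctl_inj]
        rintro rfl
        exact hs hk'
  · intro i
    rw [Layer.act_of_notMem]
    · simp
    · intro g hg
      obtain ⟨i, -, rfl⟩ := List.mem_map.1 hg
      simp [Gate.support]

/-- Controlled SWAPs of the data qubits `d` and `τ d`. -/
def cswapLayer (e : Fin m ≃ D) (τ : Equiv.Perm D) (hτ : ∀ d, τ (τ d) = d) :
    Layer (D ⊕ Fin (m + m)) where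
  gates := (List.finRange m).filterMap fun i =>
    -- One gate for each 2-cycle of τ, controlled by the qubit of its smaller element; fixed points
    -- need none.
    if h : i < e.symm (τ (e i)) then
      some (.cswap (ctl D i) (Sum.inl (e i)) (Sum.inl (τ (e i))) (ctl_ne_inl _ _) (ctl_ne_inl _ _)
        fun h' => h.ne (by rw [← Sum.inl_injective h', e.symm_apply_apply]))
    else none
  disjoint := by
    rw [List.pairwise_filterMap]
    refine (List.nodup_finRange m).imp fun {i k} h => ?_
    intro g hg g' hg'
    split_ifs at hg with hi
    · split_ifs at hg' with hk
      · simp only [Option.some.injEq] at hg hg'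
        subst hg hg'
        have h1 : τ (e i) ≠ e k := by
          intro h1
          rw [← h1, hτ, e.symm_apply_apply] at hk
          rw [h1, e.symm_apply_apply] at hi
          exact lt_asymm hi hk
        have h2 : e i ≠ τ (e k) := by
          intro h2
          exact h1 (by rw [h2, hτ])
        simp [Gate.support, h.symm, h1.symm, h2.symm]

theorem mem_cswapLayer_gates {e : Fin m ≃ D} {τ : Equiv.Perm D} {hτ : ∀ d, τ (τ d) = d}
    {g : Gate (D ⊕ Fin (m + m))} (hg : g ∈ (cswapLayer e τ hτ).gates) :
    ∃ i, i < e.symm (τ (e i)) ∧ ∃ h1 h2 h3,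
      g = .cswap (ctl D i) (Sum.inl (e i)) (Sum.inl (τ (e i))) h1 h2 h3 := by
  obtain ⟨i, -, hi⟩ := List.mem_filterMap.1 hg
  split_ifs at hi with h
  exact ⟨i, h, _, _, _, (Option.some.inj hi).symm⟩

theorem cswapLayer_mem {e : Fin m ≃ D} {τ : Equiv.Perm D} {hτ : ∀ d, τ (τ d) = d} {i : Fin m}
    (h : i < e.symm (τ (e i))) : ∃ h1 h2 h3,
      Gate.cswap (ctl D i) (Sum.inl (e i)) (Sum.inl (τ (e i))) h1 h2 h3 ∈
        (cswapLayer e τ hτ).gates :=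
  ⟨_, _, fun h' => h.ne (by rw [← Sum.inl_injective h', e.symm_apply_apply]),
    List.mem_filterMap.2 ⟨i, List.mem_finRange i, by rw [dif_pos h]⟩⟩

theorem cswapLayer_isClassical (e : Fin m ≃ D) (τ : Equiv.Perm D) (hτ : ∀ d, τ (τ d) = d) :
    (cswapLayer e τ hτ).IsClassical := by
  intro g hg a
  obtain ⟨i, -, h1, h2, h3, rfl⟩ := mem_cswapLayer_gates hg
  nofun

theorem cswapLayer_cswaps_le (e : Fin m ≃ D) (τ : Equiv.Perm D) (hτ : ∀ d, τ (τ d) = d) :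
    (cswapLayer e τ hτ).cswaps ≤ m := by
  refine List.countP_le_length.trans ((List.length_filterMap_le _ _).trans ?_)
  simp

theorem cswapLayer_act_ctl (e : Fin m ≃ D) (τ : Equiv.Perm D) (hτ : ∀ d, τ (τ d) = d)
    (x : D ⊕ Fin (m + m) → Bool) (i : Fin m) :
    (cswapLayer e τ hτ).act x (ctl D i) = x (ctl D i) := by
  by_cases h : i < e.symm (τ (e i))
  · obtain ⟨h1, h2, h3, hmem⟩ := cswapLayer_mem (hτ := hτ) h
    rw [Layer.act_of_mem _ hmem _ (by simp [Gate.support])]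
    simp only [Gate.act, swapIf]
    split_ifs
    · simp [Equiv.swap_apply_of_ne_of_ne h1 h2]
    · rfl
  · rw [Layer.act_of_notMem]
    intro g hg
    obtain ⟨k, hk, h1, h2, h3, rfl⟩ := mem_cswapLayer_gates hg
    simp only [Gate.support, Finset.mem_insert, Finset.mem_singleton, ctl_inj, ctl_ne_inl, or_false]
    rintro rfl
    exact h hk

theorem cswapLayer_act_par (e : Fin m ≃ D) (τ : Equiv.Perm D) (hτ : ∀ d, τ (τ d) = d)
    (x : D ⊕ Fin (m + m) → Bool) (i : Fin m) :
    (cswapLayer e τ hτ).act x (par D i) = x (par D i) := by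
  rw [Layer.act_of_notMem]
  intro g hg
  obtain ⟨k, hk, h1, h2, h3, rfl⟩ := mem_cswapLayer_gates hg
  simp [Gate.support]

theorem cswapLayer_act_inl (e : Fin m ≃ D) (τ : Equiv.Perm D) (hτ : ∀ d, τ (τ d) = d)
    (z : D → Bool) (b : Bool) (o : Fin m → Bool) (d : D) :
    (cswapLayer e τ hτ).act (config z (fun _ => b) o) (Sum.inl d) =
      if b then z (τ d) else z d := by
  obtain ⟨i, rfl⟩ := e.surjective d
  -- The data qubit is the smaller element of its 2-cycle, a fixed point, or the larger element,
  -- whose gate is indexed by its partner.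
  rcases lt_trichotomy i (e.symm (τ (e i))) with h | h | h
  · obtain ⟨h1, h2, h3, hmem⟩ := cswapLayer_mem (hτ := hτ) h
    rw [Layer.act_of_mem _ hmem _ (by simp [Gate.support])]
    cases b <;> simp [Gate.act, swapIf]
  · have hfix : τ (e i) = e i := by
      conv_rhs => rw [h]
      rw [Equiv.apply_symm_apply]
    rw [Layer.act_of_notMem]
    · simp [hfix]
    · intro g hg
      obtain ⟨k, hk, h1, h2, h3, rfl⟩ := mem_cswapLayer_gates hg
      simp only [Gate.support, Finset.mem_insert, Finset.mem_singleton, inl_ne_ctl,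
        Sum.inl_injective.eq_iff, e.injective.eq_iff, false_or, not_or]
      constructor
      · rintro rfl
        exact hk.ne h
      · intro h4
        have : τ (e i) = e k := by rw [h4, hτ]
        rw [hfix] at this
        rw [← e.injective this] at hk
        exact hk.ne h
  · set k := e.symm (τ (e i)) with hk
    have hek : e k = τ (e i) := by rw [hk, Equiv.apply_symm_apply]
    have hik : e i = τ (e k) := by rw [hek, hτ]
    have h' : k < e.symm (τ (e k)) := by rwa [← hik, e.symm_apply_apply]
    obtain ⟨h1, h2, h3, hmem⟩ := cswapLayer_mem (hτ := hτ) h'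
    rw [hik, Layer.act_of_mem _ hmem _ (by simp [Gate.support])]
    cases b <;> simp [Gate.act, swapIf, hτ]

theorem cswapLayer_act_const (e : Fin m ≃ D) (τ : Equiv.Perm D) (hτ : ∀ d, τ (τ d) = d)
    (z : D → Bool) (b : Bool) (o : Fin m → Bool) :
    (cswapLayer e τ hτ).act (config z (fun _ => b) o) =
      config (fun d => if b then z (τ d) else z d) (fun _ => b) o := by
  apply wire_ext
  · intro d
    rw [cswapLayer_act_inl, config_inl]
  · intro i
    rw [cswapLayer_act_ctl, config_ctl, config_ctl]
  · intro i
    rw [cswapLayer_act_par, config_par, config_par]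

/-- For nonconstant control bits the effect on the data is immaterial: such terms vanish because of
their ancilla bits, which the layer preserves. -/
theorem exists_cswapLayer_act (e : Fin m ≃ D) (τ : Equiv.Perm D) (hτ : ∀ d, τ (τ d) = d)
    (z : D → Bool) (u o : Fin m → Bool) :
    ∃ z', (cswapLayer e τ hτ).act (config z u o) = config z' u o := by
  refine ⟨fun d => (cswapLayer e τ hτ).act (config z u o) (Sum.inl d), ?_⟩
  apply wire_ext
  · intro d
    rfl
  · intro i
    rw [cswapLayer_act_ctl, config_ctl, config_ctl]
  · intro i
    rw [cswapLayer_act_par, config_par, config_par]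

/-! ### Cyclic parities -/

/-- The parities of cyclically neighbouring bits. -/
def boundary (v : Fin m → Bool) : Fin m → Bool := fun i => v i ^^ v (finRotate m i)

open Classical in
/-- A choice of bits with prescribed parities of neighbours, if there is one. -/
noncomputable def boundaryLift (o : Fin m → Bool) : Fin m → Bool :=
  if h : ∃ v, boundary v = o then h.choose else fun _ => false

/-- The chosen lift need not be v; it may be its complement. Only the parities matter, and the
ambiguity is the two branches of the GHZ state. -/
theorem boundary_boundaryLift (v : Fin m → Bool) :
    boundary (boundaryLift (boundary v)) = boundary v := by
  have h : ∃ w, boundary w = boundary v := ⟨v, rfl⟩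
  rw [boundaryLift, dif_pos h, h.choose_spec]

theorem boundary_xor (u v : Fin m → Bool) (i : Fin m) :
    boundary (fun k => u k ^^ v k) i = (boundary u i ^^ boundary v i) := by
  simp only [boundary]
  cases u i <;> cases v i <;> cases u (finRotate m i) <;> cases v (finRotate m i) <;> rfl

theorem boundary_not (u : Fin m → Bool) : boundary (fun k => !u k) = boundary u := by
  funext i
  simp only [boundary]
  cases u i <;> cases u (finRotate m i) <;> rfl

theorem exists_const_of_boundary {u : Fin m → Bool} (h : ∀ i, boundary u i = false) :
    ∃ b, u = fun _ => b := by
  cases m with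
  | zero => exact ⟨false, funext fun i => i.elim0⟩
  | succ m =>
    refine ⟨u 0, funext fun i => ?_⟩
    induction i using Fin.induction with
    | zero => rfl
    | succ i ih =>
      have := h i.castSucc
      rw [boundary, finRotate_apply, Fin.coeSucc_eq_succ, ih] at this
      cases h0 : u 0 <;> cases h1 : u i.succ <;> simp_all

/-- The outcome `o` is consistent with the corrected control bits. -/
def Consistent (u o : Fin m → Bool) : Prop := o = boundary fun k => u k ^^ boundaryLift o k

/-- Both `boundaryLift o` and its sum with u have boundary o, so u has boundary 0 and agrees at all
neighbours: after the correction only the two GHZ branches are left. -/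
theorem Consistent.exists_const {u o : Fin m → Bool} (h : Consistent u o) :
    ∃ b, u = fun _ => b := by
  apply exists_const_of_boundary
  intro i
  have h1 : boundary (boundaryLift o) = o := by
    conv_lhs => rw [h]
    rw [boundary_boundaryLift]
    exact h.symm
  have h2 := congrFun h i
  rw [boundary_xor, h1] at h2
  cases hb : boundary u i <;> cases ho : o i <;> simp_all

/-- Consistent pairs correspond to the control bits before the correction. -/
noncomputable def consistentEquiv :
    {p : (Fin m → Bool) × (Fin m → Bool) // Consistent p.1 p.2} ≃ (Fin m → Bool) where
  toFun p := fun k => p.1.1 k ^^ boundaryLift p.1.2 k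
  invFun v := ⟨(fun k => v k ^^ boundaryLift (boundary v) k, boundary v), by
    simp [Consistent]⟩
  left_inv := by
    rintro ⟨⟨u, o⟩, h⟩
    have h' : boundary (fun k => u k ^^ boundaryLift o k) = o := Eq.symm h
    simp [h']
  right_inv v := by
    funext k
    simp

/-! ### The program -/

section Program

/-- The part of the program after the measurement of the parities: correct the control qubits to
a GHZ state, apply the controlled permutations, measure the control qubits. -/
noncomputable def correctedProg (e : Fin m ≃ D) (τ₁ τ₂ : Equiv.Perm D) (h₁ : ∀ d, τ₁ (τ₁ d) = d)
    (h₂ : ∀ d, τ₂ (τ₂ d) = d) (o : Fin m → Bool) : Prog (D ⊕ Fin (m + m)) :=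
  .round (pauliLayer D (boundaryLift o)) ∅ fun _ => .round (cswapLayer e τ₁ h₁) ∅ fun _ =>
    .round (cswapLayer e τ₂ h₂) ∅ fun _ => parityProg (ctlList D m) ctlList_nodup

/-- The parity qubits. -/
def parSet (D : Type) [DecidableEq D] (m : ℕ) : Finset (D ⊕ Fin (m + m)) :=
  Finset.univ.image (par D)

/-- The program after the preparation of the control qubits in uniform superpositions. -/
noncomputable def measuredProg (e : Fin m ≃ D) (τ₁ τ₂ : Equiv.Perm D) (h₁ : ∀ d, τ₁ (τ₁ d) = d)
    (h₂ : ∀ d, τ₂ (τ₂ d) = d) : Prog (D ⊕ Fin (m + m)) :=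
  .round (cnotLayer D 1) ∅ fun _ => .round (cnotLayer D (finRotate m)) (parSet D m) fun o =>
    correctedProg e τ₁ τ₂ h₁ h₂ fun i => extendOutcome _ o (par D i)

/-- A constant-depth Hadamard test for the product of two involutive permutations. -/
noncomputable def shiftProg (e : Fin m ≃ D) (τ₁ τ₂ : Equiv.Perm D) (h₁ : ∀ d, τ₁ (τ₁ d) = d)
    (h₂ : ∀ d, τ₂ (τ₂ d) = d) : Prog (D ⊕ Fin (m + m)) :=
  .round (hadamardLayer (ctlList D m) ctlList_nodup) ∅ fun _ => measuredProg e τ₁ τ₂ h₁ h₂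

variable (e : Fin m ≃ D) (τ₁ τ₂ : Equiv.Perm D) (h₁ : ∀ d, τ₁ (τ₁ d) = d)
  (h₂ : ∀ d, τ₂ (τ₂ d) = d)

theorem shiftProg_depth : (shiftProg e τ₁ τ₂ h₁ h₂).depth ≤ 7 := by
  have hround : ∀ (L : Layer (D ⊕ Fin (m + m))) (M : Finset (D ⊕ Fin (m + m)))
      (next : (M → Bool) → Prog (D ⊕ Fin (m + m))) (k : ℕ), (∀ o, (next o).depth ≤ k) →
      (Prog.round L M next).depth ≤ 1 + k := fun L M next k h =>
    Nat.add_le_add_left (Finset.sup_le fun o _ => h o) 1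
  exact hround _ _ _ 6 fun _ => hround _ _ _ 5 fun _ => hround _ _ _ 4 fun _ =>
    hround _ _ _ 3 fun _ => hround _ _ _ 2 fun _ => hround _ _ _ 1 fun _ =>
    hround _ _ _ 0 fun _ => le_rfl

theorem shiftProg_cswaps : (shiftProg e τ₁ τ₂ h₁ h₂).cswaps ≤ 2 * m := by
  have hround : ∀ (L : Layer (D ⊕ Fin (m + m))) (M : Finset (D ⊕ Fin (m + m)))
      (next : (M → Bool) → Prog (D ⊕ Fin (m + m))) (c k : ℕ), L.cswaps ≤ c →
      (∀ o, (next o).cswaps ≤ k) → (Prog.round L M next).cswaps ≤ c + k :=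
    fun L M next c k h h' => Nat.add_le_add h (Finset.sup_le fun o _ => h' o)
  have hH : (hadamardLayer (ctlList D m) ctlList_nodup).cswaps ≤ 0 := by
    simp [Layer.cswaps, hadamardLayer, List.countP_eq_zero, Gate.isCSwap]
  have hC : ∀ π : Equiv.Perm (Fin m), (cnotLayer D π).cswaps ≤ 0 := by
    intro π
    simp [Layer.cswaps, cnotLayer, List.countP_eq_zero, Gate.isCSwap]
  have hX : ∀ s : Fin m → Bool, (pauliLayer D s).cswaps ≤ 0 := by
    intro s
    simp [Layer.cswaps, pauliLayer, List.countP_eq_zero, Gate.isCSwap]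
  have h : (shiftProg e τ₁ τ₂ h₁ h₂).cswaps ≤ 0 + (0 + (0 + (0 + (m + (m + (0 + 0)))))) :=
    hround _ _ _ _ _ hH fun _ => hround _ _ _ _ _ (hC 1) fun _ => hround _ _ _ _ _ (hC _)
    fun _ => hround _ _ _ _ _ (hX _) fun _ => hround _ _ _ _ _ (cswapLayer_cswaps_le e τ₁ h₁)
    fun _ => hround _ _ _ _ _ (cswapLayer_cswaps_le e τ₂ h₂) fun _ => hround _ _ _ _ _ hH
    fun _ => le_rfl
  exact h.trans (by omega)

/-- The action of the classical gates of the program on configurations. -/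
noncomputable def classicalAct (o : Fin m → Bool) (x : D ⊕ Fin (m + m) → Bool) :
    D ⊕ Fin (m + m) → Bool :=
  (pauliLayer D (boundaryLift o)).act ((cswapLayer e τ₁ h₁).act ((cswapLayer e τ₂ h₂).act x))

theorem exists_classicalAct (o : Fin m → Bool) (z : D → Bool) (u p : Fin m → Bool) :
    ∃ z', classicalAct e τ₁ τ₂ h₁ h₂ o (config z u p) =
      config z' (fun i => u i ^^ boundaryLift o i) p := by
  obtain ⟨z1, hz1⟩ := exists_cswapLayer_act e τ₂ h₂ z u p
  obtain ⟨z2, hz2⟩ := exists_cswapLayer_act e τ₁ h₁ z1 u p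
  exact ⟨z2, by rw [classicalAct, hz1, hz2, pauliLayer_act]⟩

theorem classicalAct_const (o : Fin m → Bool) (z : D → Bool) (b : Bool) (p : Fin m → Bool) :
    classicalAct e τ₁ τ₂ h₁ h₂ o (config z (fun _ => b) p) =
      config (fun d => if b then z (τ₂ (τ₁ d)) else z d) (fun i => b ^^ boundaryLift o i) p := by
  rw [classicalAct, cswapLayer_act_const, cswapLayer_act_const, pauliLayer_act]
  cases b <;> simp

variable [Fintype D]

theorem correctedProg_hasForm (o : Fin m → Bool) :
    (correctedProg e τ₁ τ₂ h₁ h₂ o).HasForm (classicalAct e τ₁ τ₂ h₁ h₂ o)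
      fun x => classicalAct e τ₁ τ₂ h₁ h₂ o (flipOn (ctlList D m) x) :=
  (((parityProg_hasForm _ ctlList_nodup).round_empty (cswapLayer_isClassical e τ₂ h₂)).round_empty
    (cswapLayer_isClassical e τ₁ h₁)).round_empty (pauliLayer_isClassical _)

/-- The corrected part of the program and the flip of the controls leave the parity qubits alone, so
the measured outcome can be read from x on both sides. -/
theorem measuredProg_hasForm :
    (measuredProg e τ₁ τ₂ h₁ h₂).HasForm
      (fun x => (cnotLayer D 1).act ((cnotLayer D (finRotate m)).act
        (classicalAct e τ₁ τ₂ h₁ h₂ (fun i => x (par D i)) x)))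
      (fun x => (cnotLayer D 1).act ((cnotLayer D (finRotate m)).act
        (classicalAct e τ₁ τ₂ h₁ h₂ (fun i => x (par D i)) (flipOn (ctlList D m) x)))) := by
  have hpar : ∀ o x, ∀ w ∈ parSet D m, classicalAct e τ₁ τ₂ h₁ h₂ o x w = x w := by
    intro o x w hw
    obtain ⟨i, -, rfl⟩ := Finset.mem_image.1 hw
    obtain ⟨⟨z, u, p⟩, rfl⟩ := configEquiv.surjective x
    rw [configEquiv_apply]
    obtain ⟨z', hz'⟩ := exists_classicalAct e τ₁ τ₂ h₁ h₂ o z u p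
    rw [hz', config_par, config_par]
  have hflip : ∀ (x : D ⊕ Fin (m + m) → Bool), ∀ w ∈ parSet D m,
      flipOn (ctlList D m) x w = x w := by
    intro x w hw
    obtain ⟨i, -, rfl⟩ := Finset.mem_image.1 hw
    simp [flipOn, par_notMem_ctlList]
  have h := (Prog.HasForm.round (M := parSet D m) (cnotLayer_isClassical (finRotate m))
    (fun o => correctedProg_hasForm e τ₁ τ₂ h₁ h₂ fun i => extendOutcome _ o (par D i))
    (fun o x w hw => hpar _ _ w hw)
    (fun o x w hw => (hpar _ _ w hw).trans (hflip x w hw))).round_empty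
    (cnotLayer_isClassical (D := D) 1)
  have hext : ∀ (x : D ⊕ Fin (m + m) → Bool) (i : Fin m),
      extendOutcome (parSet D m) (fun w => x w) (par D i) = x (par D i) := by
    intro x i
    have hmem : par D i ∈ parSet D m := Finset.mem_image_of_mem _ (Finset.mem_univ i)
    rw [extendOutcome, dif_pos hmem]
  simp only [hext] at h
  exact h

/-- The expectation of the test on ancillas in the state `|0⟩`. -/
theorem shiftProg_expect (R : (D → Bool) → (D → Bool) → ℂ) (T : ℂ)
    (hT : ∑ z, R z (fun d => z (τ₂ (τ₁ d))) = T) (hT' : ∑ z, R (fun d => z (τ₂ (τ₁ d))) z = T) :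
    (shiftProg e τ₁ τ₂ h₁ h₂).expect (Matrix.of fun x y =>
      if (∀ i, x (Sum.inr i) = false) ∧ (∀ i, y (Sum.inr i) = false) then
        R (fun d => x (Sum.inl d)) (fun d => y (Sum.inl d)) else 0) = T := by
  classical
  set S : Matrix (D ⊕ Fin (m + m) → Bool) (D ⊕ Fin (m + m) → Bool) ℂ := Matrix.of fun x y =>
      if (∀ i, x (Sum.inr i) = false) ∧ (∀ i, y (Sum.inr i) = false) then
        R (fun d => x (Sum.inl d)) (fun d => y (Sum.inl d)) else 0 with hS
  have hS0 : ∀ x y, ∀ a ∈ ctlList D m, x a = true ∨ y a = true → S x y = 0 := by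
    intro x y a ha h
    obtain ⟨i, -, rfl⟩ := List.mem_map.1 ha
    rw [hS, Matrix.of_apply, if_neg]
    rintro ⟨hx, hy⟩
    have hx' := hx (Fin.castAdd m i)
    have hy' := hy (Fin.castAdd m i)
    simp only [ctl] at h
    simp [hx', hy'] at h
  have hSc : ∀ z z' o o', S (config z (fun _ => false) o) (config z' (fun _ => false) o') =
      if (∀ i, o i = false) ∧ (∀ i, o' i = false) then R z z' else 0 := by
    intro z z' o o'
    have h : ∀ (z : D → Bool) (o : Fin m → Bool), (∀ i, config z (fun _ => false) o (Sum.inr i) = false) ↔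
        ∀ i, o i = false := by
      intro z o
      constructor
      · intro h i
        rw [← config_par z (fun _ => false) o i]
        exact h _
      · intro h i
        refine Fin.addCases (fun i => ?_) (fun i => ?_) i
        · exact config_ctl z (fun _ => false) o i
        · exact (config_par z (fun _ => false) o i).trans (h i)
    rw [hS, Matrix.of_apply]
    simp only [h, config_inl]
  have hpost : ∀ o x y, postState (hadamardLayer (ctlList D m) ctlList_nodup) ∅ o S x y =
      (1 / 2) ^ m * S (zeroOn (ctlList D m) x) (zeroOn (ctlList D m) y) := by
    intro o x y
    rw [postState_apply, if_pos (by simp), hadamardLayer_matrix,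
      hadamards_conj_apply ctlList_nodup hS0]
    simp [ctlList]
  -- Propagated back to the input, a term survives only if the parity qubits return to 0, which says
  -- that o is consistent with u. Complementing u changes no parity, so row and column impose the
  -- same condition. Then u is constant, and exactly one of the two sides has its data shifted.
  have hentry : ∀ z u o, S
      (zeroOn (ctlList D m) ((cnotLayer D 1).act ((cnotLayer D (finRotate m)).act
        (classicalAct e τ₁ τ₂ h₁ h₂ o (config z u o)))))
      (zeroOn (ctlList D m) ((cnotLayer D 1).act ((cnotLayer D (finRotate m)).act
        (classicalAct e τ₁ τ₂ h₁ h₂ o (config z (fun i => !u i) o))))) =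
      if Consistent u o then
        R (if u = fun _ => true then fun d => z (τ₂ (τ₁ d)) else z)
          (if u = fun _ => true then z else fun d => z (τ₂ (τ₁ d))) else 0 := by
    intro z u o
    have hiff : ∀ v : Fin m → Bool, (∀ i, (o i ^^ v (finRotate m i) ^^ v i) = false) ↔
        o = boundary v := by
      intro v
      rw [funext_iff]
      refine forall_congr' fun i => ?_
      rw [boundary]
      cases o i <;> cases v i <;> cases v (finRotate m i) <;> simp
    have hnot : boundary (fun i => !u i ^^ boundaryLift o i) =
        boundary (fun i => u i ^^ boundaryLift o i) := by
      funext i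
      rw [boundary_xor, boundary_xor, boundary_not]
    by_cases hc : Consistent u o
    · rw [if_pos hc]
      by_cases hu : u = fun _ => true
      · have hn : (fun i => !u i) = fun _ => false := by rw [hu]; rfl
        have hc2 : o = boundary fun i => true ^^ boundaryLift o i := by
          rw [Consistent, hu] at hc
          exact hc
        have hc3 : o = boundary fun i => false ^^ boundaryLift o i := by
          rw [Consistent, ← hnot, hu] at hc
          exact hc
        rw [if_pos hu, if_pos hu, hn, hu, classicalAct_const, classicalAct_const, cnotLayer_act,
          cnotLayer_act, cnotLayer_act, cnotLayer_act, zeroOn_config, zeroOn_config, hSc]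
        refine (if_pos ⟨(hiff fun i => true ^^ boundaryLift o i).2 hc2,
          (hiff fun i => false ^^ boundaryLift o i).2 hc3⟩).trans ?_
        simp
      · obtain ⟨b, hb⟩ := hc.exists_const
        have hbf : b = false := by
          cases b
          · rfl
          · exact absurd hb hu
        subst hbf
        have hn : (fun i => !u i) = fun _ => true := by rw [hb]; rfl
        have hc2 : o = boundary fun i => false ^^ boundaryLift o i := by
          rw [Consistent, hb] at hc
          exact hc
        have hc3 : o = boundary fun i => true ^^ boundaryLift o i := by
          rw [Consistent, ← hnot, hb] at hc
          exact hc
        rw [if_neg hu, if_neg hu, hn, hb, classicalAct_const, classicalAct_const, cnotLayer_act,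
          cnotLayer_act, cnotLayer_act, cnotLayer_act, zeroOn_config, zeroOn_config, hSc]
        refine (if_pos ⟨(hiff fun i => false ^^ boundaryLift o i).2 hc2,
          (hiff fun i => true ^^ boundaryLift o i).2 hc3⟩).trans ?_
        simp
    · obtain ⟨z₁, hz₁⟩ := exists_classicalAct e τ₁ τ₂ h₁ h₂ o z u o
      obtain ⟨z₂, hz₂⟩ := exists_classicalAct e τ₁ τ₂ h₁ h₂ o z (fun i => !u i) o
      rw [if_neg hc, hz₁, hz₂, cnotLayer_act, cnotLayer_act, cnotLayer_act, cnotLayer_act,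
        zeroOn_config, zeroOn_config, hSc]
      exact if_neg fun h => hc ((hiff fun i => u i ^^ boundaryLift o i).1 h.1)
  have hsum : ∀ p : (Fin m → Bool) × (Fin m → Bool), ∑ z, (if Consistent p.1 p.2 then
        R (if p.1 = fun _ => true then fun d => z (τ₂ (τ₁ d)) else z)
          (if p.1 = fun _ => true then z else fun d => z (τ₂ (τ₁ d))) else 0) =
      if Consistent p.1 p.2 then T else 0 := by
    intro p
    split_ifs
    · exact hT'
    · exact hT
    · exact Finset.sum_const_zero
  -- Consistent pairs correspond to the 2^m control strings before the correction, which cancels the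
  -- normalization (1/2)^m of the superposition.
  have hcard : (Finset.univ.filter fun p : (Fin m → Bool) × (Fin m → Bool) =>
      Consistent p.1 p.2).card = 2 ^ m := by
    rw [← Fintype.card_subtype, Fintype.card_congr consistentEquiv]
    simp
  simp only [shiftProg, Prog.expect, measuredProg_hasForm e τ₁ τ₂ h₁ h₂ _, hpost]
  rw [Fintype.sum_unique, ← Finset.mul_sum, ← Equiv.sum_comp configEquiv, Fintype.sum_prod_type,
    Finset.sum_comm]
  simp only [configEquiv_apply, flipOn_config, config_par, hentry, hsum]
  rw [← Finset.sum_filter, Finset.sum_const, hcard, nsmul_eq_mul, ← mul_assoc]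
  push_cast
  rw [← mul_pow]
  norm_num

end Program

end ShiftTest

/-! ## Cyclic shifts and traces of powers -/

section Cyclic

/-- A sum over walks from a to b with intermediate vertices w: `Fin.cons a w` lists the starting
points of the steps and `Fin.snoc w b` their end points. -/
theorem pow_succ_apply_eq_sum {ι : Type*} [Fintype ι] [DecidableEq ι] (M : Matrix ι ι ℂ) (j : ℕ)
    (a b : ι) : (M ^ (j + 1)) a b =
      ∑ w : Fin j → ι, ∏ i : Fin (j + 1),
        M ((Fin.cons a w : Fin (j + 1) → ι) i) ((Fin.snoc w b : Fin (j + 1) → ι) i) := by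
  induction j generalizing a with
  | zero => simp [Fin.snoc]
  | succ j ih =>
    rw [pow_succ', Matrix.mul_apply, ← Equiv.sum_comp (Fin.consEquiv fun _ => ι),
      Fintype.sum_prod_type]
    refine Finset.sum_congr rfl fun y _ => ?_
    rw [ih, Finset.mul_sum]
    refine Finset.sum_congr rfl fun w _ => ?_
    have h : (Fin.snoc (Fin.cons y w : Fin (j + 1) → ι) b : Fin (j + 2) → ι) =
        (Fin.cons y (Fin.snoc w b : Fin (j + 1) → ι) : Fin (j + 2) → ι) :=
      (Fin.cons_snoc_eq_snoc_cons (β := ι) y w b).symm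
    change _ = ∏ i, M ((Fin.cons a (Fin.cons y w : Fin (j + 1) → ι) : Fin (j + 2) → ι) i)
      ((Fin.snoc (Fin.cons y w : Fin (j + 1) → ι) b : Fin (j + 2) → ι) i)
    rw [h, Fin.prod_univ_succ (n := j + 1)]
    simp only [Fin.cons_zero, Fin.cons_succ]

theorem sum_prod_finRotate {ι : Type*} [Fintype ι] [DecidableEq ι] (M : Matrix ι ι ℂ) {j : ℕ}
    (hj : 1 ≤ j) : ∑ z : Fin j → ι, ∏ c, M (z c) (z (finRotate j c)) = (M ^ j).trace := by
  obtain ⟨j, rfl⟩ : ∃ j', j = j' + 1 := ⟨j - 1, by omega⟩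
  rw [Matrix.trace, ← Equiv.sum_comp (Fin.consEquiv fun _ => ι), Fintype.sum_prod_type]
  refine Finset.sum_congr rfl fun a _ => ?_
  rw [Matrix.diag_apply, pow_succ_apply_eq_sum]
  refine Finset.sum_congr rfl fun w _ => Finset.prod_congr rfl fun i _ => ?_
  congr 1
  simp only [Fin.consEquiv_apply]
  induction i using Fin.lastCases with
  | last => simp
  | cast i => rw [finRotate_apply, Fin.coeSucc_eq_succ, Fin.cons_succ, Fin.snoc_castSucc]

/-- Rotation after reversal is a reflection of the cycle, hence an involution; its product with the
reversal is the rotation. -/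
theorem finRotate_rev_finRotate_rev (j : ℕ) (i : Fin j) :
    finRotate j (Fin.rev (finRotate j (Fin.rev i))) = i := by
  cases j with
  | zero => exact i.elim0
  | succ j => rw [finRotate_apply, finRotate_apply, Fin.rev_add, Fin.rev_rev, sub_add_cancel]

/-- The permutation of the qubits induced by a permutation of the copies. -/
def copyPerm {j : ℕ} (n : ℕ) (r : Equiv.Perm (Fin j)) : Equiv.Perm (Fin j × Fin n) :=
  r.prodCongr (Equiv.refl _)

/-- The circuit that estimates `Tr(ρ^j)`: the cyclic shift of the copies is the product of two
reflections. -/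
noncomputable def traceCircuit (n j : ℕ) : Circuit n j where
  -- One control and one parity qubit for each data qubit.
  ancillas := j * n + j * n
  prog := shiftProg finProdFinEquiv.symm (copyPerm n Fin.revPerm)
    (copyPerm n (Fin.revPerm.trans (finRotate j))) (fun ⟨c, q⟩ => by simp [copyPerm])
    (fun ⟨c, q⟩ => Prod.ext (finRotate_rev_finRotate_rev j c) rfl)

theorem traceCircuit_expect (n : ℕ) {j : ℕ} (hj : 1 ≤ j)
    (ρ : Matrix (Fin n → Bool) (Fin n → Bool) ℂ) :
    (traceCircuit n j).prog.expect (inputState j (traceCircuit n j).ancillas ρ) =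
      (ρ ^ j).trace := by
  have hsum : ∀ F : (Fin j → Fin n → Bool) → ℂ,
      ∑ z : Fin j × Fin n → Bool, F (fun c q => z (c, q)) = ∑ z, F z := fun F =>
    Equiv.sum_comp (Equiv.curry (Fin j) (Fin n) Bool) F
  refine shiftProg_expect _ _ _ _ _
    (fun z z' => ∏ c : Fin j, ρ (fun q => z (c, q)) (fun q => z' (c, q))) _ ?_ ?_
  · rw [← sum_prod_finRotate ρ hj, ← hsum]
    simp [copyPerm]
  -- In the other GHZ branch rows and columns are exchanged, which amounts to the transpose of ρ and
  -- gives the same trace.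
  · rw [← Matrix.trace_transpose, Matrix.transpose_pow, ← sum_prod_finRotate ρᵀ hj, ← hsum]
    simp [copyPerm]

theorem traceCircuit_size (n j : ℕ) : (traceCircuit n j).prog.depth ≤ 7 ∧
    (traceCircuit n j).qubits ≤ 7 * (n * j) ∧ (traceCircuit n j).prog.cswaps ≤ 7 * (n * j) := by
  refine ⟨shiftProg_depth _ _ _ _ _, ?_, (shiftProg_cswaps _ _ _ _ _).trans ?_⟩
  · change j * n + (j * n + j * n) ≤ 7 * (n * j)
    rw [mul_comm n j]
    omega
  · rw [mul_comm n j]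
    omega

end Cyclic

/-! ## Concentration of the estimates -/

section Concentration

open MeasureTheory ProbabilityTheory

/-- The sign of an output bit. -/
def bitSign (b : Bool) : ℝ := if b then -1 else 1

theorem bitSign_mem_Icc (b : Bool) : bitSign b ∈ Set.Icc (-1 : ℝ) 1 := by
  cases b <;> norm_num [bitSign]

theorem integral_bitSign_law {n j : ℕ} (hj : 1 ≤ j) (ρ : QState (Fin n → Bool)) :
    ∫ b, bitSign b ∂((traceCircuit n j).law ρ).toMeasure = (ρ.mat ^ j).trace.re := by
  rw [← traceCircuit_expect n hj, ← Prog.prob_false_sub_prob_true, PMF.integral_eq_sum]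
  have hnn : ∀ b, 0 ≤ (traceCircuit n j).prog.prob
      (inputState j (traceCircuit n j).ancillas ρ.mat) b := fun b =>
    (traceCircuit n j).prog.prob_nonneg (inputState_posSemidef j _ ρ.posSemidef) b
  simp [Circuit.law, bitSign, ENNReal.toReal_ofReal, hnn]
  ring

theorem trace_pow_eq_re {ι : Type*} [Fintype ι] [DecidableEq ι] (ρ : QState ι) (j : ℕ) :
    (ρ.mat ^ j).trace = ((ρ.mat ^ j).trace.re : ℂ) := by
  rw [trace_pow_eq_sum_eigenvalues ρ.posSemidef.isHermitian, ← Complex.ofReal_sum,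
    Complex.ofReal_re]

instance {n : ℕ} (circ : ∀ j, Circuit n j) (ρ : QState (Fin n → Bool)) (t N : ℕ) :
    IsProbabilityMeasure (runsMeasure circ ρ t N) := by
  unfold runsMeasure
  infer_instance

/-- Hoeffding's lemma: values in an interval of length 2 give the variance proxy (2/2)² = 1 after
centering. -/
theorem hasSubgaussianMGF_run {n t N : ℕ} (ρ : QState (Fin n → Bool)) (s : Fin t × Fin N) :
    HasSubgaussianMGF (fun ω => bitSign (ω s) - (ρ.mat ^ (s.1.1 + 1)).trace.re) 1
      (runsMeasure (traceCircuit n) ρ t N) := by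
  have h := hasSubgaussianMGF_of_mem_Icc (μ := runsMeasure (traceCircuit n) ρ t N)
    (X := fun ω => bitSign (ω s)) (a := -1) (b := 1) (measurable_of_finite _).aemeasurable
    (Filter.Eventually.of_forall fun ω => bitSign_mem_Icc _)
  have hi : ∫ ω, bitSign (ω s) ∂(runsMeasure (traceCircuit n) ρ t N) =
      (ρ.mat ^ (s.1.1 + 1)).trace.re := by
    rw [← integral_bitSign_law (by omega) ρ]
    have hmp := measurePreserving_eval
      (fun s : Fin t × Fin N => ((traceCircuit n (s.1.1 + 1)).law ρ).toMeasure) s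
    rw [← hmp.map_eq, integral_map hmp.measurable.aemeasurable
      (measurable_of_finite _).aestronglyMeasurable]
    rfl
  rw [hi] at h
  have h1 : ((‖(1 : ℝ) - -1‖₊ / 2) ^ 2 : NNReal) = 1 := by
    ext
    norm_num
  rwa [h1] at h

theorem iIndepFun_runs {n t N : ℕ} (ρ : QState (Fin n → Bool)) (f : Fin t × Fin N → Bool → ℝ) :
    iIndepFun (fun s (ω : Fin t × Fin N → Bool) => f s (ω s))
      (runsMeasure (traceCircuit n) ρ t N) :=
  iIndepFun_pi fun _ => (measurable_of_finite _).aemeasurable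

theorem measure_sum_runs_ge_le {n t N : ℕ} (ρ : QState (Fin n → Bool)) (s : Fin t) {η c : ℝ}
    (hη : 0 ≤ η) (hc : c = 1 ∨ c = -1) :
    (runsMeasure (traceCircuit n) ρ t N).real {ω | N * η ≤ ∑ r : Fin N,
      c * (bitSign (ω (s, r)) - (ρ.mat ^ (s.1 + 1)).trace.re)} ≤ Real.exp (-(N * η ^ 2 / 2)) := by
  have hind := (iIndepFun_runs (N := N) ρ (fun s b =>
    c * (bitSign b - (ρ.mat ^ (s.1.1 + 1)).trace.re))).precomp
    (g := fun r : Fin N => (s, r)) (fun a b h => (Prod.mk.inj h).2)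
  have hsub : ∀ r ∈ (Finset.univ : Finset (Fin N)), HasSubgaussianMGF
      (fun ω : Fin t × Fin N → Bool =>
        c * (bitSign (ω (s, r)) - (ρ.mat ^ (s.1 + 1)).trace.re)) 1
      (runsMeasure (traceCircuit n) ρ t N) := by
    intro r _
    have h := hasSubgaussianMGF_run ρ (s, r)
    rcases hc with rfl | rfl
    · simpa using h
    · convert h.neg using 1
      funext ω
      simp
  have h := HasSubgaussianMGF.measure_sum_ge_le_of_iIndepFun hind hsub
    (ε := N * η) (by positivity)
  refine h.trans (le_of_eq ?_)
  congr 1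
  -- The exponent comes as (Nη)² / (2N); N = 0 is separate only because of the division.
  rcases Nat.eq_zero_or_pos N with rfl | hN
  · simp
  · have : (N : ℝ) ≠ 0 := by positivity
    simp
    field_simp

theorem measure_estimate_ge_le {n t N : ℕ} (hN : 0 < N) (ρ : QState (Fin n → Bool)) (s : Fin t)
    {η : ℝ} (hη : 0 ≤ η) :
    (runsMeasure (traceCircuit n) ρ t N).real
      {ω | η ≤ ‖estimate ω (s.1 + 1) - (ρ.mat ^ (s.1 + 1)).trace‖} ≤
      2 * Real.exp (-(N * η ^ 2 / 2)) := by
  have hN' : (0 : ℝ) < N := Nat.cast_pos.2 hN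
  have hsubset : {ω : Fin t × Fin N → Bool |
      η ≤ ‖estimate ω (s.1 + 1) - (ρ.mat ^ (s.1 + 1)).trace‖} ⊆
      {ω | N * η ≤ ∑ r : Fin N,
        1 * (bitSign (ω (s, r)) - (ρ.mat ^ (s.1 + 1)).trace.re)} ∪
      {ω | N * η ≤ ∑ r : Fin N,
        -1 * (bitSign (ω (s, r)) - (ρ.mat ^ (s.1 + 1)).trace.re)} := by
    intro ω hω
    have hest : estimate ω (s.1 + 1) - (ρ.mat ^ (s.1 + 1)).trace =
        (((∑ r : Fin N, (bitSign (ω (s, r)) - (ρ.mat ^ (s.1 + 1)).trace.re)) / N : ℝ) : ℂ) := by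
      have hs : 1 ≤ s.1 + 1 ∧ s.1 + 1 ≤ t := ⟨by omega, s.2⟩
      have hN0 : (N : ℂ) ≠ 0 := by exact_mod_cast hN.ne'
      rw [estimate, dif_pos hs, trace_pow_eq_re]
      simp only [Nat.add_sub_cancel, Fin.eta]
      rw [Finset.sum_sub_distrib]
      push_cast
      simp only [Finset.sum_const, Finset.card_univ, Fintype.card_fin, nsmul_eq_mul]
      rw [sub_div, mul_div_cancel_left₀ _ hN0]
      congr 2
      refine Finset.sum_congr rfl fun r _ => ?_
      cases ω (s, r) <;> simp [bitSign]
    rw [Set.mem_ofPred_eq, hest, Complex.norm_real, Real.norm_eq_abs, abs_div,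
      abs_of_pos hN', le_div_iff₀ hN', mul_comm, le_abs] at hω
    simpa only [Set.mem_union, Set.mem_ofPred_eq, one_mul, neg_one_mul, Finset.sum_neg_distrib]
      using hω
  refine (measureReal_mono hsubset).trans ((measureReal_union_le _ _).trans ?_)
  rw [two_mul]
  exact add_le_add (measure_sum_runs_ge_le ρ s hη (Or.inl rfl))
    (measure_sum_runs_ge_le ρ s hη (Or.inr rfl))

/-- Union bound over the t circuits, each failing with probability at most 2 exp(-Nη²/2). -/
theorem one_sub_le_measure_estimates {n t N : ℕ} (hN : 0 < N) (ρ : QState (Fin n → Bool))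
    {η δ : ℝ} (hη : 0 ≤ η) (hδ : t * (2 * Real.exp (-(N * η ^ 2 / 2))) ≤ δ) :
    1 - δ ≤ (runsMeasure (traceCircuit n) ρ t N).real
      {ω | ∀ j, 1 ≤ j → j ≤ t → ‖estimate ω j - (ρ.mat ^ j).trace‖ < η} := by
  set μ := runsMeasure (traceCircuit n) ρ t N
  set G := {ω : Fin t × Fin N → Bool |
    ∀ j, 1 ≤ j → j ≤ t → ‖estimate ω j - (ρ.mat ^ j).trace‖ < η}
  have hG : Gᶜ ⊆ ⋃ s : Fin t, {ω : Fin t × Fin N → Bool |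
      η ≤ ‖estimate ω (s.1 + 1) - (ρ.mat ^ (s.1 + 1)).trace‖} := by
    intro ω hω
    simp only [G, Set.mem_compl_iff, Set.mem_ofPred_eq, not_forall, not_lt] at hω
    obtain ⟨j, h1, h2, h3⟩ := hω
    obtain ⟨j, rfl⟩ : ∃ j', j = j' + 1 := ⟨j - 1, by omega⟩
    exact Set.mem_iUnion.2 ⟨⟨j, h2⟩, h3⟩
  have h1 : μ.real Gᶜ ≤ δ := by
    refine (measureReal_mono hG).trans ((measureReal_iUnion_fintype_le _).trans ?_)
    refine (Finset.sum_le_sum fun s _ => measure_estimate_ge_le hN ρ s hη).trans ?_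
    simpa using hδ
  have h2 := probReal_compl_eq_one_sub (μ := μ) (s := G) (Set.toFinite G).measurableSet
  linarith

end Concentration

/-! ## The number of runs -/

section Runs

/-- A number of runs that suffices for accuracy `η` with failure probability `δ`. -/
noncomputable def runs (t : ℕ) (η δ : ℝ) : ℕ := ⌈2 / η ^ 2 * Real.log (2 * t / δ)⌉₊

theorem runs_failure {t : ℕ} {η δ : ℝ} (ht : 0 < t) (hη : 0 < η) (hδ : 0 < δ) :
    t * (2 * Real.exp (-(runs t η δ * η ^ 2 / 2))) ≤ δ := by
  have ht' : (0 : ℝ) < t := Nat.cast_pos.2 ht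
  have h1 : Real.log (2 * t / δ) ≤ runs t η δ * η ^ 2 / 2 := by
    have := Nat.le_ceil (2 / η ^ 2 * Real.log (2 * t / δ))
    change _ ≤ (runs t η δ : ℝ) at this
    rw [div_mul_eq_mul_div, div_le_iff₀ (by positivity)] at this
    linarith
  have h2 : Real.exp (-(runs t η δ * η ^ 2 / 2)) ≤ δ / (2 * t) := by
    calc Real.exp (-(runs t η δ * η ^ 2 / 2)) ≤ Real.exp (-Real.log (2 * t / δ)) := by gcongr
      _ = δ / (2 * t) := by
        rw [Real.exp_neg, Real.exp_log (by positivity), inv_div]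
  calc t * (2 * Real.exp (-(runs t η δ * η ^ 2 / 2))) ≤ t * (2 * (δ / (2 * t))) := by gcongr
    _ = δ := by field_simp

theorem runs_pos {t : ℕ} {η δ : ℝ} (ht : 0 < t) (hη : 0 < η) (hδ : 0 < δ) (hδ1 : δ < 1) :
    0 < runs t η δ := by
  have ht' : (1 : ℝ) ≤ t := by exact_mod_cast ht
  have : 0 < Real.log (2 * t / δ) := by
    apply Real.log_pos
    rw [lt_div_iff₀ hδ]
    linarith
  exact Nat.ceil_pos.2 (by positivity)

theorem runs_le {k : ℕ} {ε δ : ℝ} (hε : 0 < ε) (hε1 : ε ≤ 1) (ht : 4 ≤ cutoff k ε) (hδ : 0 < δ)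
    (hδ1 : δ < 1) :
    (cutoff k ε * runs (cutoff k ε) (accuracy k ε) δ : ℝ) ≤
      26 * Real.log (2 * k / ε) ^ 6 * ((k : ℝ) ^ 2 / ε ^ 2 * Real.log (2 / δ)) := by
  have hk : (1 : ℝ) ≤ k := by exact_mod_cast pos_of_cutoff ht
  have htL := cutoff_le_log ht
  have ht' : (4 : ℝ) ≤ cutoff k ε := by exact_mod_cast ht
  have hlog := one_lt_log_cutoff ht
  have hη := accuracy_pos hε ht
  have hacc : 2 / accuracy k ε ^ 2 =
      8 * ((k : ℝ) ^ 2 / ε ^ 2) * ((cutoff k ε : ℝ) * Real.log (cutoff k ε)) ^ 2 := by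
    unfold accuracy
    field_simp
    norm_num
  have hΛ : 1 / 2 ≤ Real.log (2 / δ) := by
    have h1 := Real.log_two_gt_d9
    have h2 : Real.log 2 ≤ Real.log (2 / δ) := by
      apply Real.log_le_log (by norm_num)
      rw [le_div_iff₀ hδ]
      linarith
    linarith
  have hsplit : Real.log (2 * cutoff k ε / δ) = Real.log (cutoff k ε) + Real.log (2 / δ) := by
    rw [← Real.log_mul (by positivity) (by positivity)]
    congr 1
    ring
  have hlogt : Real.log (cutoff k ε) ≤ cutoff k ε := Real.log_le_self (by positivity)
  have hN : (runs (cutoff k ε) (accuracy k ε) δ : ℝ) ≤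
      2 / accuracy k ε ^ 2 * Real.log (2 * cutoff k ε / δ) + 1 := by
    refine (Nat.ceil_lt_add_one ?_).le
    rw [hsplit]
    have : 0 ≤ Real.log (cutoff k ε : ℝ) + Real.log (2 / δ) := by linarith
    positivity
  rw [hacc, hsplit] at hN
  set t : ℝ := (cutoff k ε : ℝ)
  set L := Real.log (2 * k / ε)
  set Λ := Real.log (2 / δ)
  set q := (k : ℝ) ^ 2 / ε ^ 2 with hq
  have hq1 : 1 ≤ q := by
    rw [hq, ← div_pow]
    apply one_le_pow₀
    rw [le_div_iff₀ hε]
    linarith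
  have hL : 4 ≤ L := ht'.trans htL
  have h1 : (t * Real.log t) ^ 2 ≤ L ^ 4 := by
    calc (t * Real.log t) ^ 2 ≤ (L * L) ^ 2 := by gcongr; exact hlogt.trans htL
      _ = L ^ 4 := by ring
  -- As Λ ≥ 1/2 and L ≥ 4, both ln t ≤ L ≤ 2LΛ and Λ ≤ LΛ. This gives the main term 8 · 3 = 24.
  have h2 : Real.log t + Λ ≤ 3 * (L * Λ) := by nlinarith
  -- The cost of rounding N up, t ≤ L, which raises 24 to 26.
  have h3 : L ≤ 2 * (L ^ 6 * (q * Λ)) := by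
    have h4 : 1 / 2 ≤ q * Λ := by nlinarith
    have h5 : L ≤ L ^ 6 := le_self_pow₀ (by linarith) (by norm_num)
    nlinarith [mul_le_mul h5 h4 (by norm_num) (by positivity)]
  calc t * runs (cutoff k ε) (accuracy k ε) δ
      ≤ L * (8 * q * (t * Real.log t) ^ 2 * (Real.log t + Λ) + 1) := by gcongr
    _ ≤ L * (8 * q * L ^ 4 * (3 * (L * Λ)) + 1) := by
      have : 0 ≤ Real.log t + Λ := by linarith
      gcongr
    _ = 24 * L ^ 6 * (q * Λ) + L := by ring
    _ ≤ 26 * L ^ 6 * (q * Λ) := by linarith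

end Runs

/-! ### Assembly of the extrapolation, the circuits and the concentration bound -/

theorem corollary2 :
    -- (1) accurate estimates of `Tr(ρ^j)`, `j ≤ t = ⌊ln(2k/ε)⌋`, suffice for all `i ≤ k`
    (∀ (d k : ℕ) (ε : ℝ) (ρ : QState (Fin d)) (Q : ℕ → ℂ), 0 < ε → ε ≤ 1 → 4 ≤ cutoff k ε →
      (∀ j, 1 ≤ j → j ≤ cutoff k ε → ‖Q j - (ρ.mat ^ j).trace‖ < accuracy k ε) →
      ∀ i, 1 ≤ i → i ≤ k → ‖newtonPower Q (cutoff k ε) i - (ρ.mat ^ i).trace‖ < ε) ∧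
    -- (2) such estimates are obtained from few runs of small constant-depth circuits
    ∃ (A : ℝ) (a : ℕ) (B : ℕ) (circ : ∀ n j : ℕ, Circuit n j),
      (∀ n j, 1 ≤ n → 1 ≤ j →
        (circ n j).prog.depth ≤ B ∧
        (circ n j).qubits ≤ B * (n * j) ∧
        (circ n j).prog.cswaps ≤ B * (n * j)) ∧
      ∀ (k : ℕ) (ε δ : ℝ), 0 < ε → ε ≤ 1 → 4 ≤ cutoff k ε → 0 < δ → δ < 1 →
        ∃ N : ℕ,
          (cutoff k ε * N : ℝ) ≤
            A * Real.log (2 * k / ε) ^ a * ((k : ℝ) ^ 2 / ε ^ 2 * Real.log (2 / δ)) ∧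
          ∀ (n : ℕ) (ρ : QState (Fin n → Bool)), 1 ≤ n →
            1 - δ ≤ (runsMeasure (circ n) ρ (cutoff k ε) N).real
              {ω | (∀ j, 1 ≤ j → j ≤ cutoff k ε →
                      ‖estimate ω j - (ρ.mat ^ j).trace‖ < accuracy k ε) ∧
                   ∀ i, 1 ≤ i → i ≤ k →
                      ‖newtonPower (estimate ω) (cutoff k ε) i - (ρ.mat ^ i).trace‖ < ε} := by
  refine ⟨fun d k ε ρ Q hε h1 ht hQ i hi hik =>
    norm_newtonPower_sub_trace_lt k ρ Q hε h1 ht hQ i hi hik,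
    -- The values A = 26 and a = 6 come from `runs_le`. B = 7 is the depth bound, and it also
    -- exceeds the factors 3 and 2 for qubits and CSWAPs.
    26, 6, 7, traceCircuit, fun n j _ _ => traceCircuit_size n j, ?_⟩
  intro k ε δ hε h1 ht hδ hδ1
  have ht0 : 0 < cutoff k ε := by omega
  have hη := accuracy_pos hε ht
  refine ⟨runs (cutoff k ε) (accuracy k ε) δ, runs_le hε h1 ht hδ hδ1, fun n ρ _ => ?_⟩
  refine (one_sub_le_measure_estimates (runs_pos ht0 hη hδ hδ1) ρ hη.le
    (runs_failure ht0 hη hδ)).trans (MeasureTheory.measureReal_mono ?_)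
  exact fun ω hω => ⟨hω, norm_newtonPower_sub_trace_lt k ρ (estimate ω) hε h1 ht hω⟩
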